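/- Let $G=(V,c)$ be a countably infinite weighted graph: $V$ is countably infinite and $c:V\times V\to[0,\infty)$ satisfies $c(x,y)=c(y,x)$ and $c(x,x)=0$; $x,y$ are adjacent if $c(x,y)>0$. Assume that $G$ is connected and that $c_x:=\sum_{y}c(x,y)<\infty$ for all $x\in V$. Let $\mathcal E(u,v)=\frac12\sum_{x,y\in V}c(x,y)(u(x)-u(y))(v(x)-v(y))$ and $\mathcal E(u)=\mathcal E(u,u)$. Let $\operatorname{dom}\mathcal E$ be the set of all $u:V\to\mathbb R$ with $\mathcal E(u)<\infty$, and let $\mathcal Fin$ be the set of all $u:V\to\mathbb R$ that are constant outside a finite set. For $\mathcal D\subseteq\operatorname{dom}\mathcal E$ put $$R_{\mathcal D}(x,y)=\left(\inf\{\mathcal E(u): u\in\mathcal D,\ u(x)=1,\ u(y)=0\}\right)^{-1}\quad(x\ne y),\qquad R_{\mathcal D}(x,x)=0 .$$ $(\mathcal E,\mathcal D)$ is a *resistance form* (Kigami) if: $\mathcal D$ is a linear space containing the constants, on which $\mathcal E$ is a non-negative symmetric bilinear form vanishing exactly on the constants; $\mathcal D$ modulo constants is complete for $\mathcal E$; every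 real function on a finite subset of $V$ extends to an element of $\mathcal D$; $\sup\{|u(p)-u(q)|^2/\mathcal E(u):u\in\mathcal D,\ \mathcal E(u)>0\}<\infty$ for all $p,q\in V$; and for $u\in\mathcal D$ the function $\bar u=\min\{1,\max\{u,0\}\}$ lies in $\mathcal D$ and satisfies $\mathcal E(\bar u)\le\mathcal E(u)$. For a finite connected weighted graph, the effective resistance between $x$ and $y$ is $\phi(x)$, where $\phi$ is the solution of $\Delta\phi=\frac1{c_x}\mathbf 1_x-\frac1{c_y}\mathbf 1_y$, $\phi(y)=0$, with $(\Delta f)(z)=f(z)-\sum_w\frac{c(z,w)}{c_z}f(w)$. A *finite exhaustion* of $V$ is an increasing sequence of finite non-empty sets $V_n$ with union $V$. A graph $(V,c')$ is the *limit graph* of $R:V\times V\to\mathbb R$ if, for every finite exhaustion $(V_n)$, there is for each $n$ exactly one connected weighted graph $(V_n,c_n)$ with effective resistance $R|_{V_n\times V_n}$, and $c_n(x,y)\to c'(x,y)$ for all $x,y\in V$. Then: 1. If $\mathcal Fin\subseteq\mathcal D\subseteq\operatorname{dom}\mathcal E$ and $(\mathcal E,\mathcal D)$ is a resistance form, then $G$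 is the limit graph of $R_{\mathcal D}$. 2. Let $R^F(x,y)$ be the free effective resistance of $G$, that is, the limit of the effective resistances between $x$ and $y$ in the subgraphs of $G$ induced on $V_n$, along any finite exhaustion with connected induced subgraphs. This limit exists and $R^F=R_{\operatorname{dom}\mathcal E}$; moreover $\mathcal Fin\subseteq\operatorname{dom}\mathcal E$ and $(\mathcal E,\operatorname{dom}\mathcal E)$ is a resistance form, and $G$ is the limit graph of $R^F$. 3. Let $R^W(x,y)$ be the wired effective resistance of $G$, defined in the same way but with $V\setminus V_n$ identified to a single additional vertex (without loops) instead of deleted. This limit exists and $R^W=R_{\mathcal Fin}$; moreover $R^W=R_{\mathcal D}$ for some $\mathcal D$ with $\mathcal Fin\subseteq\mathcal D\subseteq\operatorname{dom}\mathcal E$ such that $(\mathcal E,\mathcal D)$ is a resistance form, and $G$ is the limit graph of $R^W$. -/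

import Mathlib

open Filter Topology

/-- A weighted graph on the vertex set `V`: a symmetric non-negative weight function vanishing on
the diagonal. Two vertices are adjacent when their weight is positive. -/
@[ext]
structure WeightedGraph (V : Type*) where
  c : V → V → ℝ
  nonneg : ∀ x y, 0 ≤ c x y
  symm : ∀ x y, c x y = c y x
  diag : ∀ x, c x x = 0

namespace WeightedGraph

variable {V : Type*}

/-- The underlying simple graph: `x` and `y` are adjacent iff `c x y > 0`. -/
def toSimpleGraph (G : WeightedGraph V) : SimpleGraph V where
  Adj x y := 0 < G.c x y
  symm := ⟨fun x y h => by rw [G.symm y x]; exact h⟩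
  loopless := ⟨fun x h => by rw [G.diag x] at h; exact lt_irrefl 0 h⟩

/-- Connectedness (this includes that there is at least one vertex). -/
def Connected (G : WeightedGraph V) : Prop := G.toSimpleGraph.Connected

/-- Local finiteness in the sense of finite total weight at each vertex. -/
def LocallyFinite (G : WeightedGraph V) : Prop := ∀ x, Summable (G.c x)

/-- The total weight `c_x` at the vertex `x`. -/
noncomputable def totalWeight (G : WeightedGraph V) (x : V) : ℝ := ∑' y, G.c x y

/-- The normalized Laplacian `(Δ f)(x) = f x - ∑ y, c(x,y) / c_x * f y`. -/
noncomputable def laplacian (G : WeightedGraph V) (f : V → ℝ) (x : V) : ℝ :=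
  f x - ∑' y, G.c x y / G.totalWeight x * f y

open Classical in
/-- `φ` solves the discrete Dirichlet problem `Δ φ = 1_x / c_x - 1_y / c_y`, `φ y = 0`. -/
def IsDirichletSolution (G : WeightedGraph V) (x y : V) (φ : V → ℝ) : Prop :=
  (∀ z, G.laplacian φ z =
    (if z = x then 1 / G.totalWeight x else 0) - (if z = y then 1 / G.totalWeight y else 0)) ∧
  φ y = 0

open Classical in
/-- The effective resistance between `x` and `y` in a finite connected graph: `φ x`, where `φ` is
the solution of the Dirichlet problem (it exists and is unique in such a graph). The value is `0`
if there is no solution. -/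
noncomputable def effectiveResistance (G : WeightedGraph V) (x y : V) : ℝ :=
  if h : ∃ φ, G.IsDirichletSolution x y φ then h.choose x else 0

/-- The (polarized) energy form
`E(u,v) = 1/2 * ∑ x y, c(x,y) (u x - u y) (v x - v y)`; it is used on functions of finite energy,
where the series converges absolutely. -/
noncomputable def energyForm (G : WeightedGraph V) (u v : V → ℝ) : ℝ :=
  1 / 2 * ∑' p : V × V, G.c p.1 p.2 * (u p.1 - u p.2) * (v p.1 - v p.2)

/-- `dom E`: the functions of finite energy (the energy is a series of non-negative terms). -/
def domE (G : WeightedGraph V) : Set (V → ℝ) :=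
  {u | Summable fun p : V × V => G.c p.1 p.2 * (u p.1 - u p.2) ^ 2}

/-- The subgraph induced on a finite set of vertices. -/
def induce (G : WeightedGraph V) (W : Finset V) : WeightedGraph W where
  c x y := G.c x y
  nonneg x y := G.nonneg x y
  symm x y := G.symm x y
  diag x := G.diag x

/-- The weights of the wired graph on a finite set `W` of vertices: the vertices outside `W` are
identified to the single vertex `none`, and loops at that vertex are removed. -/
noncomputable def wiredWeight (G : WeightedGraph V) (W : Finset V) :
    Option W → Option W → ℝ
  | some x, some y => G.c x y
  | some x, none => ∑' z : {z : V // z ∉ W}, G.c x z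
  | none, some y => ∑' z : {z : V // z ∉ W}, G.c y z
  | none, none => 0

/-- The wired graph on a finite set `W` of vertices. -/
noncomputable def wire (G : WeightedGraph V) (W : Finset V) : WeightedGraph (Option W) where
  c := G.wiredWeight W
  nonneg x y := by
    rcases x with _ | x <;> rcases y with _ | y
    · exact le_refl 0
    · exact tsum_nonneg fun z => G.nonneg _ _
    · exact tsum_nonneg fun z => G.nonneg _ _
    · exact G.nonneg _ _
  symm x y := by
    rcases x with _ | x <;> rcases y with _ | y
    · rfl
    · rfl
    · rfl
    · exact G.symm _ _
  diag x := by
    rcases x with _ | x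
    · rfl
    · exact G.diag _

end WeightedGraph

/-- `Fin`: the functions that are constant outside a finite set. -/
def finiteFunctions (V : Type*) : Set (V → ℝ) :=
  {u | ∃ k : ℝ, ∃ W : Finset V, ∀ x, x ∉ W → u x = k}

/-- Resistance forms `(E, F)` on a set `X`, in the sense of Kigami. Only the values of `E` on `F`
matter. -/
structure IsResistanceForm {X : Type*} (E : (X → ℝ) → (X → ℝ) → ℝ) (F : Set (X → ℝ)) : Prop where
  /-- (RF1) `F` is a linear space of functions containing the constants, and `E` is a non-negative
  symmetric bilinear form on `F` which vanishes exactly on the constants. -/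
  const_mem : ∀ k : ℝ, (fun _ => k) ∈ F
  add_mem : ∀ u ∈ F, ∀ v ∈ F, u + v ∈ F
  smul_mem : ∀ a : ℝ, ∀ u ∈ F, a • u ∈ F
  map_add : ∀ u ∈ F, ∀ v ∈ F, ∀ w ∈ F, E (u + v) w = E u w + E v w
  map_smul : ∀ a : ℝ, ∀ u ∈ F, ∀ v ∈ F, E (a • u) v = a * E u v
  map_symm : ∀ u ∈ F, ∀ v ∈ F, E u v = E v u
  map_nonneg : ∀ u ∈ F, 0 ≤ E u u
  map_eq_zero_iff : ∀ u ∈ F, (E u u = 0 ↔ ∃ k : ℝ, ∀ x, u x = k)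
  /-- (RF2) The quotient of `F` by the constants, with inner product `E`, is complete. -/
  complete : ∀ u : ℕ → X → ℝ, (∀ n, u n ∈ F) →
    (∀ ε > 0, ∃ N, ∀ m ≥ N, ∀ n ≥ N, E (u m - u n) (u m - u n) < ε) →
    ∃ v ∈ F, Tendsto (fun n => E (u n - v) (u n - v)) atTop (𝓝 0)
  /-- (RF3) Every function on a finite set extends to an element of `F`. -/
  extend : ∀ (W : Finset X) (v : X → ℝ), ∃ u ∈ F, ∀ x ∈ W, u x = v x
  /-- (RF4) For all points `p`, `q`, the supremum of `|u p - u q|² / E(u,u)` over the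
  non-constant `u` in `F` is finite. -/
  bounded : ∀ p q : X, ∃ C : ℝ, ∀ u ∈ F, (u p - u q) ^ 2 ≤ C * E u u
  /-- (RF5) The Markov property. -/
  markov : ∀ u ∈ F, (fun x => min 1 (max (u x) 0)) ∈ F ∧
    E (fun x => min 1 (max (u x) 0)) (fun x => min 1 (max (u x) 0)) ≤ E u u

/-- `R(x,y) = (inf {E(u,u) | u ∈ F, u x = 1, u y = 0})⁻¹`. For `x = y` the infimum runs over the
empty set, and the value is `0`. -/
noncomputable def resistance {X : Type*} (E : (X → ℝ) → (X → ℝ) → ℝ) (F : Set (X → ℝ))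
    (x y : X) : ℝ :=
  (sInf {r : ℝ | ∃ u ∈ F, u x = 1 ∧ u y = 0 ∧ r = E u u})⁻¹

/-- A finite exhaustion: an increasing sequence of finite sets whose union is everything. -/
def IsFiniteExhaustion {V : Type*} (W : ℕ → Finset V) : Prop :=
  Monotone W ∧ ∀ x, ∃ n, x ∈ W n

/-- `K` is a connected graph on the finite set `W` whose effective resistance is the restriction
of `R` to `W`. -/
def RepresentsOn {V : Type*} (R : V → V → ℝ) (W : Finset V) (K : WeightedGraph W) : Prop :=
  K.Connected ∧ ∀ x y : W, K.effectiveResistance x y = R x y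

open Classical in
/-- `H` is the limit graph of `R`: for every exhaustion by finite non-empty sets `W n` there is,
for each `n`, exactly one connected graph `K n` on `W n` with effective resistance `R` restricted
to `W n`, and the edge weights of the graphs `K n` converge to those of `H`. -/
def IsLimitGraph {V : Type*} (R : V → V → ℝ) (H : WeightedGraph V) : Prop :=
  ∀ W : ℕ → Finset V, IsFiniteExhaustion W → (∀ n, (W n).Nonempty) →
    ∃ K : ∀ n, WeightedGraph (W n),
      (∀ n, RepresentsOn R (W n) (K n) ∧ ∀ K₀, RepresentsOn R (W n) K₀ → K₀ = K n) ∧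
      ∀ x y, Tendsto
        (fun n => if h : x ∈ W n ∧ y ∈ W n then (K n).c ⟨x, h.1⟩ ⟨y, h.2⟩ else 0)
        atTop (𝓝 (H.c x y))

open Classical in
/-- `R` is the free effective resistance of `G`: along every exhaustion by finite sets inducing
connected subgraphs, the effective resistances of the induced subgraphs converge to `R`. -/
def IsFreeEffectiveResistance {V : Type*} (G : WeightedGraph V) (R : V → V → ℝ) : Prop :=
  ∀ W : ℕ → Finset V, IsFiniteExhaustion W → (∀ n, (G.induce (W n)).Connected) →
    ∀ x y, Tendsto
      (fun n => if h : x ∈ W n ∧ y ∈ W n then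
        (G.induce (W n)).effectiveResistance ⟨x, h.1⟩ ⟨y, h.2⟩ else 0)
      atTop (𝓝 (R x y))

open Classical in
/-- `R` is the wired effective resistance of `G`: along every exhaustion by finite sets inducing
connected subgraphs, the effective resistances of the wired graphs converge to `R`. -/
def IsWiredEffectiveResistance {V : Type*} (G : WeightedGraph V) (R : V → V → ℝ) : Prop :=
  ∀ W : ℕ → Finset V, IsFiniteExhaustion W → (∀ n, (G.induce (W n)).Connected) →
    ∀ x y, Tendsto
      (fun n => if h : x ∈ W n ∧ y ∈ W n then
        (G.wire (W n)).effectiveResistance (some ⟨x, h.1⟩) (some ⟨y, h.2⟩) else 0)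
      atTop (𝓝 (R x y))

/-!
The trace of a resistance form on a finite set `W`, given by the energies of harmonic extensions,
is the energy form of a graph on `W`: its weights are non-negative by the Markov property. It has
the same resistances as the form, and a finite connected graph is determined by its resistances
because they determine the Green functions. So the finite graph on `W` represented by `R_D` is the
trace. Since the indicator function of a vertex `y` has finite energy and lies in the domain, the
weight of the trace between `x` and `y` is `∑ z, c y z * h_x z`, where `h_x` is the harmonic
extension of the indicator function of `x` on `W`. As `0 ≤ h_x ≤ 1` and `h_x` agrees with the
indicator function of `x` on `W`, dominated convergence along an exhaustion gives `c x y`.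

For the free resistance, energy minimizers on the induced subgraphs take values in `[0, 1]`, hence
have pointwise limits along ultrafilters, and energy is lower semicontinuous. For the wired
resistance, functions on the wired graphs are exactly the functions on `V` constant outside the
finite set, with the same energy; the closure of these functions in the energy seminorm is a
resistance form with the same resistance.
-/

open scoped InnerProductSpace

section Clamp

variable {X : Type*}

/-- The truncation of a function to the unit interval, as in the Markov property. -/
def clamp (u : X → ℝ) : X → ℝ := fun x => min 1 (max (u x) 0)

theorem clamp_mem_Icc (u : X → ℝ) (x : X) : clamp u x ∈ Set.Icc (0 : ℝ) 1 :=
  ⟨le_min zero_le_one (le_max_right _ _), min_le_left _ _⟩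

theorem clamp_of_mem_Icc {u : X → ℝ} {x : X} (hx : u x ∈ Set.Icc (0 : ℝ) 1) :
    clamp u x = u x := by
  rw [clamp, max_eq_left hx.1, min_eq_right hx.2]

theorem clamp_of_nonpos {u : X → ℝ} {x : X} (hx : u x ≤ 0) : clamp u x = 0 := by
  rw [clamp, max_eq_right hx, min_eq_right zero_le_one]

theorem abs_clamp_sub_clamp_le (u : X → ℝ) (x y : X) :
    |clamp u x - clamp u y| ≤ |u x - u y| := by
  calc |clamp u x - clamp u y| ≤ |max (u x) 0 - max (u y) 0| := by
        simpa [clamp] using abs_min_sub_min_le_max 1 (max (u x) 0) 1 (max (u y) 0)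
    _ ≤ |u x - u y| := by simpa using abs_max_sub_max_le_max (u x) 0 (u y) 0

theorem tendsto_clamp_apply {ι : Type*} {l : Filter ι} {u : ι → X → ℝ} {v : X → ℝ} {x : X}
    (hu : Tendsto (fun i => u i x) l (𝓝 (v x))) :
    Tendsto (fun i => clamp (u i) x) l (𝓝 (clamp v x)) :=
  tendsto_const_nhds.min (hu.max tendsto_const_nhds)

end Clamp

section Resistance

variable {X : Type*} {E : (X → ℝ) → (X → ℝ) → ℝ} {A : Set (X → ℝ)} {x y : X}

theorem inv_resistance_le (hA : ∀ u ∈ A, 0 ≤ E u u) {u : X → ℝ} (hu : u ∈ A) (hx : u x = 1)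
    (hy : u y = 0) : (resistance E A x y)⁻¹ ≤ E u u := by
  rw [resistance, inv_inv]
  refine csInf_le ⟨0, ?_⟩ ⟨u, hu, hx, hy, rfl⟩
  rintro _ ⟨v, hv, _, _, rfl⟩
  exact hA v hv

theorem le_inv_resistance {b : ℝ} (hne : ∃ u ∈ A, u x = 1 ∧ u y = 0)
    (hb : ∀ u ∈ A, u x = 1 → u y = 0 → b ≤ E u u) : b ≤ (resistance E A x y)⁻¹ := by
  obtain ⟨u, hu, hx, hy⟩ := hne
  rw [resistance, inv_inv]
  refine le_csInf ⟨_, u, hu, hx, hy, rfl⟩ ?_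
  rintro _ ⟨v, hv, hvx, hvy, rfl⟩
  exact hb v hv hvx hvy

theorem exists_energy_lt_of_inv_resistance_lt {b : ℝ} (hne : ∃ u ∈ A, u x = 1 ∧ u y = 0)
    (hb : (resistance E A x y)⁻¹ < b) : ∃ u ∈ A, u x = 1 ∧ u y = 0 ∧ E u u < b := by
  contrapose! hb
  exact le_inv_resistance hne hb

theorem resistance_self (E : (X → ℝ) → (X → ℝ) → ℝ) (A : Set (X → ℝ)) (x : X) :
    resistance E A x x = 0 := by
  have hempty : {r : ℝ | ∃ u ∈ A, u x = 1 ∧ u x = 0 ∧ r = E u u} = ∅ := by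
    rw [Set.eq_empty_iff_forall_notMem]
    rintro _ ⟨u, _, hx, hx', _⟩
    exact one_ne_zero (hx.symm.trans hx')
  rw [resistance, hempty, Real.sInf_empty, inv_zero]

end Resistance

section ReproducingKernel

variable {𝕜 X V H ι : Type*} [RCLike 𝕜] [NormedAddCommGroup V] [InnerProductSpace 𝕜 V]
  [CompleteSpace V] [NormedAddCommGroup H] [InnerProductSpace 𝕜 H] [CompleteSpace H]
  [RKHS 𝕜 H X V] {l : Filter ι} {f : ι → H} {g : H} {C : ℝ}

theorem tendsto_inner_of_tendsto_apply (hC : ∀ i, ‖f i‖ ≤ C)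
    (hfg : ∀ x, Tendsto (fun i => f i x) l (𝓝 (g x))) (k : H) :
    Tendsto (fun i => ⟪f i, k⟫_𝕜) l (𝓝 ⟪g, k⟫_𝕜) := by
  have hbound : ∃ C, ∀ i, ‖innerSL 𝕜 (f i)‖ ≤ C :=
    ⟨C, fun i => (innerSL_apply_norm 𝕜 (f i)).trans_le (hC i)⟩
  have hequi : Equicontinuous fun i => ⇑(innerSL 𝕜 (f i)) :=
    ((NormedSpace.equicontinuous_TFAE fun i => innerSL 𝕜 (f i)).out 5 1).1 hbound
  have hclosed : IsClosed {k : H | Tendsto (fun i => ⟪f i, k⟫_𝕜) l (𝓝 ⟪g, k⟫_𝕜)} :=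
    hequi.isClosed_setOfPred_tendsto (innerSL 𝕜 g).continuous
  have hspan : ∀ k ∈ Submodule.span 𝕜 {RKHS.kerFun H x v | (x) (v)},
      Tendsto (fun i => ⟪f i, k⟫_𝕜) l (𝓝 ⟪g, k⟫_𝕜) := by
    intro k hk
    induction hk using Submodule.span_induction with
    | mem k hk =>
      obtain ⟨x, v, rfl⟩ := hk
      simpa only [RKHS.inner_kerFun] using (hfg x).inner tendsto_const_nhds
    | zero => simpa only [inner_zero_right] using tendsto_const_nhds
    | add k k' _ _ hk hk' => simpa only [inner_add_right] using hk.add hk'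
    | smul a k _ hk => simpa only [inner_smul_right] using hk.const_mul a
  have hdense : k ∈ (Submodule.span 𝕜 {RKHS.kerFun H x v | (x) (v)}).topologicalClosure :=
    (RKHS.kerFun_dense H).symm ▸ Submodule.mem_top
  exact closure_minimal hspan hclosed hdense

theorem mem_topologicalClosure_of_tendsto_apply [l.NeBot] {M : Submodule 𝕜 H}
    (hM : ∀ i, f i ∈ M) (hC : ∀ i, ‖f i‖ ≤ C)
    (hfg : ∀ x, Tendsto (fun i => f i x) l (𝓝 (g x))) : g ∈ M.topologicalClosure := by
  rw [← M.orthogonal_orthogonal_eq_closure, Submodule.mem_orthogonal']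
  intro k hk
  refine tendsto_nhds_unique (tendsto_inner_of_tendsto_apply hC hfg k) ?_
  simpa only [Submodule.inner_right_of_mem_orthogonal (hM _) hk] using tendsto_const_nhds

end ReproducingKernel

namespace IsResistanceForm

variable {X : Type*} {E : (X → ℝ) → (X → ℝ) → ℝ} {F : Set (X → ℝ)}

/-- The domain of a resistance form as a linear subspace of the space of all functions. -/
def domain (h : IsResistanceForm E F) : Submodule ℝ (X → ℝ) where
  carrier := F
  zero_mem' := h.const_mem 0
  add_mem' hu hv := h.add_mem _ hu _ hv
  smul_mem' a _ hu := h.smul_mem a _ hu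

/-- A resistance form as a bilinear form on its domain. -/
noncomputable def form (h : IsResistanceForm E F) : LinearMap.BilinForm ℝ h.domain :=
  LinearMap.mk₂ ℝ (fun u v => E u v)
    (fun u v w => h.map_add u u.2 v v.2 w w.2)
    (fun a u v => h.map_smul a u u.2 v v.2)
    (fun u v w => by
      rw [h.map_symm _ u.2 _ (v + w).2, h.map_symm _ u.2 _ v.2, h.map_symm _ u.2 _ w.2]
      exact h.map_add v v.2 w w.2 u u.2)
    (fun a u v => by
      rw [h.map_symm _ u.2 _ (a • v).2, h.map_symm _ u.2 _ v.2]
      exact h.map_smul a v v.2 u u.2)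

variable (h : IsResistanceForm E F) {u v w : X → ℝ}

section Bilinear

include h

theorem sub_mem (hu : u ∈ F) (hv : v ∈ F) : u - v ∈ F :=
  h.domain.sub_mem hu hv

theorem clamp_mem (hu : u ∈ F) : clamp u ∈ F :=
  (h.markov u hu).1

theorem map_clamp_le (hu : u ∈ F) : E (clamp u) (clamp u) ≤ E u u :=
  (h.markov u hu).2

theorem map_sub_left (hu : u ∈ F) (hv : v ∈ F) (hw : w ∈ F) : E (u - v) w = E u w - E v w :=
  h.form.map_sub₂ ⟨u, hu⟩ ⟨v, hv⟩ ⟨w, hw⟩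

theorem map_sub_right (hu : u ∈ F) (hv : v ∈ F) (hw : w ∈ F) : E u (v - w) = E u v - E u w :=
  (h.form ⟨u, hu⟩).map_sub ⟨v, hv⟩ ⟨w, hw⟩

theorem map_smul_right (a : ℝ) (hu : u ∈ F) (hv : v ∈ F) : E u (a • v) = a * E u v :=
  (h.form ⟨u, hu⟩).map_smul a ⟨v, hv⟩

theorem map_smul_smul (a : ℝ) (hu : u ∈ F) : E (a • u) (a • u) = a ^ 2 * E u u := by
  rw [h.map_smul a u hu _ (h.smul_mem a u hu), h.map_smul_right a hu hu, sq, mul_assoc]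

theorem sum_smul_mem {ι : Type*} {s : Finset ι} {a : ι → ℝ} {f : ι → X → ℝ}
    (hf : ∀ i ∈ s, f i ∈ F) : ∑ i ∈ s, a i • f i ∈ F :=
  h.domain.sum_mem fun i hi => h.domain.smul_mem (a i) (hf i hi)

theorem map_sum_smul_left {ι : Type*} {s : Finset ι} {a : ι → ℝ} {f : ι → X → ℝ}
    (hf : ∀ i ∈ s, f i ∈ F) (hv : v ∈ F) :
    E (∑ i ∈ s, a i • f i) v = ∑ i ∈ s, a i * E (f i) v := by
  classical
  induction s using Finset.induction_on with
  | empty =>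
    simpa only [zero_smul, zero_mul, Finset.sum_empty] using h.map_smul 0 0 (h.const_mem 0) v hv
  | insert i s hi ih =>
    rw [Finset.forall_mem_insert] at hf
    rw [Finset.sum_insert hi, Finset.sum_insert hi,
      h.map_add _ (h.smul_mem _ _ hf.1) _ (h.sum_smul_mem hf.2) v hv, h.map_smul _ _ hf.1 v hv,
      ih hf.2]

theorem sq_map_le (hu : u ∈ F) (hv : v ∈ F) : E u v ^ 2 ≤ E u u * E v v := by
  have hcs := h.form.apply_mul_apply_le_of_forall_zero_le (fun w => h.map_nonneg w w.2)
    ⟨u, hu⟩ ⟨v, hv⟩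
  change E u v * E v u ≤ E u u * E v v at hcs
  rwa [h.map_symm v hv u hu, ← sq] at hcs

theorem map_const_left (k : ℝ) (hu : u ∈ F) : E (fun _ => k) u = 0 := by
  have hk : E (fun _ => k) (fun _ => k) = 0 :=
    (h.map_eq_zero_iff _ (h.const_mem k)).2 ⟨k, fun _ => rfl⟩
  have hcs := h.sq_map_le (h.const_mem k) hu
  rw [hk, zero_mul] at hcs
  exact pow_eq_zero_iff two_ne_zero |>.1 (hcs.antisymm (sq_nonneg _))

theorem map_const_right (k : ℝ) (hu : u ∈ F) : E u (fun _ => k) = 0 := by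
  rw [h.map_symm u hu _ (h.const_mem k), h.map_const_left k hu]

theorem map_sub_const_left (k : ℝ) (hu : u ∈ F) (hv : v ∈ F) :
    E (u - fun _ => k) v = E u v := by
  rw [h.map_sub_left hu (h.const_mem k) hv, h.map_const_left k hv, sub_zero]

theorem map_sub_const_right (k : ℝ) (hu : u ∈ F) (hv : v ∈ F) :
    E u (v - fun _ => k) = E u v := by
  rw [h.map_sub_right hu hv (h.const_mem k), h.map_const_right k hu, sub_zero]

theorem map_self_eq_add_of_orthogonal (hu : u ∈ F) (hv : v ∈ F) (huv : E v (u - v) = 0) :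
    E u u = E v v + E (u - v) (u - v) := by
  have hd := h.sub_mem hu hv
  have := h.map_sub_left hu hv hd
  have := h.map_sub_right hu hu hv
  have := h.map_sub_right hv hu hv
  have := h.map_symm u hu v hv
  linarith

theorem map_nonpos_of_forall_map_le (hu : u ∈ F) (hv : v ∈ F)
    (huv : ∀ t > (0 : ℝ), E u u ≤ E (u - t • v) (u - t • v)) : E u v ≤ 0 := by
  have hquad : ∀ t > 0, 2 * E u v ≤ t * E v v := by
    intro t ht
    have htv := h.smul_mem t v hv
    have hexpand : E (u - t • v) (u - t • v) = E u u - 2 * t * E u v + t ^ 2 * E v v := by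
      rw [h.map_sub_left hu htv (h.sub_mem hu htv), h.map_sub_right hu hu htv,
        h.map_sub_right htv hu htv, h.map_smul_smul t hv, h.map_smul_right t hu hv,
        h.map_smul t v hv u hu, h.map_symm v hv u hu]
      ring
    refine le_of_mul_le_mul_left ?_ ht
    linarith [huv t ht]
  have hlim : Tendsto (fun t : ℝ => t * E v v) (𝓝[>] 0) (𝓝 0) := by
    simpa using ((continuous_mul_const (E v v)).tendsto 0).mono_left nhdsWithin_le_nhds
  have := ge_of_tendsto hlim (eventually_mem_nhdsWithin.mono hquad)
  linarith

end Bilinear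

/-- The functions in the domain of a resistance form that vanish at the base point `o`. They
represent the classes modulo constants, and form a Hilbert space with the form as inner product. -/
def Pinned (h : IsResistanceForm E F) (o : X) : Type _ :=
  ↥(h.domain ⊓ LinearMap.ker (LinearMap.proj o : (X → ℝ) →ₗ[ℝ] ℝ))

namespace Pinned

variable {h} {o : X}

noncomputable instance : AddCommGroup (h.Pinned o) :=
  inferInstanceAs (AddCommGroup ↥(h.domain ⊓ LinearMap.ker (LinearMap.proj o)))

noncomputable instance : Module ℝ (h.Pinned o) :=
  inferInstanceAs (Module ℝ ↥(h.domain ⊓ LinearMap.ker (LinearMap.proj o)))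

noncomputable instance innerProductCore : InnerProductSpace.Core ℝ (h.Pinned o) where
  inner f g := E f.1 g.1
  conj_inner_symm f g := h.map_symm _ g.2.1 _ f.2.1
  re_inner_nonneg f := h.map_nonneg _ f.2.1
  add_left f g k := h.map_add _ f.2.1 _ g.2.1 _ k.2.1
  smul_left f g a := h.map_smul a _ f.2.1 _ g.2.1
  definite f hf := by
    obtain ⟨k, hk⟩ := (h.map_eq_zero_iff _ f.2.1).1 hf
    exact Subtype.ext (funext fun x => ((hk x).trans (hk o).symm).trans f.2.2)

noncomputable instance : NormedAddCommGroup (h.Pinned o) :=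
  innerProductCore.toNormedAddCommGroup

noncomputable instance : InnerProductSpace ℝ (h.Pinned o) :=
  InnerProductSpace.ofCore innerProductCore.toCore

theorem exists_abs_apply_le (x : X) : ∃ C, ∀ f : h.Pinned o, |f.1 x| ≤ C * ‖f‖ := by
  obtain ⟨C, hC⟩ := h.bounded x o
  refine ⟨√C, fun f => ?_⟩
  have hbase : f.1 o = 0 := f.2.2
  have hnorm : E f.1 f.1 = ‖f‖ ^ 2 := real_inner_self_eq_norm_sq f
  have hf : f.1 x ^ 2 ≤ C * ‖f‖ ^ 2 := by
    simpa only [hbase, sub_zero, hnorm] using hC f.1 f.2.1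
  calc |f.1 x| ≤ √(C * ‖f‖ ^ 2) := Real.abs_le_sqrt hf
    _ = √C * ‖f‖ := by rw [Real.sqrt_mul' _ (sq_nonneg _), Real.sqrt_sq (norm_nonneg f)]

theorem continuous_val : Continuous fun f : h.Pinned o => f.1 := by
  refine continuous_pi fun x => ?_
  obtain ⟨C, hC⟩ := exists_abs_apply_le (h := h) (o := o) x
  let eval : h.Pinned o →ₗ[ℝ] ℝ := (LinearMap.proj x).comp (Submodule.subtype _)
  exact AddMonoidHomClass.continuous_of_bound eval C hC

noncomputable instance : RKHS ℝ (h.Pinned o) X ℝ where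
  coeCLM :=
    { toFun := fun f => f.1
      map_add' := fun _ _ => rfl
      map_smul' := fun _ _ => rfl
      cont := continuous_val }
  coeCLM_injective := Subtype.val_injective

theorem mem (f : h.Pinned o) : ⇑f ∈ F := f.2.1

theorem apply_base (f : h.Pinned o) : f o = 0 := f.2.2

theorem norm_sq (f : h.Pinned o) : ‖f‖ ^ 2 = E f f :=
  (real_inner_self_eq_norm_sq f).symm

end Pinned

/-- The representative of `u` modulo constants that vanishes at `o`. -/
def pin (o : X) (hu : u ∈ F) : h.Pinned o :=
  ⟨u - fun _ => u o, h.sub_mem hu (h.const_mem _), sub_self (u o)⟩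

section Pin

variable {o : X} (hu : u ∈ F) (hv : v ∈ F)

theorem coe_pin : ⇑(h.pin o hu) = u - fun _ => u o := rfl

theorem inner_pin_right (f : h.Pinned o) : ⟪f, h.pin o hu⟫_ℝ = E f u :=
  h.map_sub_const_right _ f.mem hu

theorem inner_pin_pin : ⟪h.pin o hu, h.pin o hv⟫_ℝ = E u v := by
  rw [inner_pin_right, coe_pin, h.map_sub_const_left _ hu hv]

theorem norm_pin_sq : ‖h.pin o hu‖ ^ 2 = E u u := by
  rw [← real_inner_self_eq_norm_sq, inner_pin_pin]

theorem pin_add_pin : h.pin o hu + h.pin o hv = h.pin o (h.add_mem u hu v hv) := by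
  ext x
  simp only [RKHS.coe_add, coe_pin, Pi.add_apply, Pi.sub_apply]
  ring

theorem smul_pin (a : ℝ) : a • h.pin o hu = h.pin o (h.smul_mem a u hu) := by
  ext x
  simp only [RKHS.coe_smul, coe_pin, Pi.smul_apply, Pi.sub_apply, smul_sub]

theorem pin_sub_pin : h.pin o hu - h.pin o hv = h.pin o (h.sub_mem hu hv) := by
  ext x
  simp only [RKHS.coe_sub, coe_pin, Pi.sub_apply]
  ring

theorem pin_of_apply_eq_zero (ho : u o = 0) : ⇑(h.pin o hu) = u := by
  ext x
  simp only [coe_pin, ho, Pi.sub_apply, sub_zero]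

theorem pin_coe (f : h.Pinned o) : h.pin o f.mem = f :=
  DFunLike.coe_injective (h.pin_of_apply_eq_zero f.mem f.apply_base)

theorem tendsto_pin_iff {ι : Type*} {l : Filter ι} {f : ι → X → ℝ} (hf : ∀ i, f i ∈ F) :
    Tendsto (fun i => h.pin o (hf i)) l (𝓝 (h.pin o hu)) ↔
      Tendsto (fun i => E (f i - u) (f i - u)) l (𝓝 0) := by
  rw [tendsto_iff_norm_sub_tendsto_zero]
  simp only [pin_sub_pin, ← h.norm_pin_sq (o := o) (h.sub_mem (hf _) hu)]
  exact ⟨fun H => by simpa using H.pow 2, fun H => by simpa using H.sqrt⟩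

end Pin

instance (o : X) : CompleteSpace (h.Pinned o) := by
  refine Metric.complete_of_cauchySeq_tendsto fun f hf => ?_
  have hcauchy : ∀ ε > 0, ∃ N, ∀ m ≥ N, ∀ n ≥ N,
      E (f m - f n : X → ℝ) (f m - f n : X → ℝ) < ε := by
    intro ε hε
    obtain ⟨N, hN⟩ := Metric.cauchySeq_iff.1 hf (√ε) (Real.sqrt_pos.2 hε)
    refine ⟨N, fun m hm n hn => ?_⟩
    rw [← RKHS.coe_sub, ← Pinned.norm_sq (f m - f n), ← dist_eq_norm]
    exact (Real.lt_sqrt dist_nonneg).1 (hN m hm n hn)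
  obtain ⟨v, hv, hlim⟩ := h.complete _ (fun n => (f n).mem) hcauchy
  refine ⟨h.pin o hv, ?_⟩
  simpa only [pin_coe] using (h.tendsto_pin_iff (o := o) hv fun n => (f n).mem).2 hlim

section Green

/-- The Green function `g` of a resistance form with pole `x`, grounded at `o`:
`E(g, u) = u x - u o` for all `u` in the domain. -/
noncomputable def green (o x : X) : X → ℝ := RKHS.kerFun (h.Pinned o) x (1 : ℝ)

variable (o x y : X)

theorem green_mem : h.green o x ∈ F := Pinned.mem _

theorem green_base : h.green o x o = 0 := Pinned.apply_base _

theorem map_green (hu : u ∈ F) : E (h.green o x) u = u x - u o := by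
  rw [green, ← inner_pin_right h hu, RKHS.kerFun_inner, coe_pin]
  simp

theorem map_green_self : E (h.green o x) (h.green o x) = h.green o x x := by
  rw [h.map_green _ _ (h.green_mem o x), green_base, sub_zero]

include h in
theorem exists_mem_eq_one_eq_zero {x y : X} (hxy : x ≠ y) : ∃ u ∈ F, u x = 1 ∧ u y = 0 := by
  classical
  obtain ⟨u, hu, huv⟩ := h.extend {x, y} (Pi.single x 1)
  refine ⟨u, hu, ?_, ?_⟩
  · rw [huv x (by simp), Pi.single_eq_same]
  · rw [huv y (by simp), Pi.single_eq_of_ne hxy.symm]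

theorem one_le_green_mul (hu : u ∈ F) (hx : u x = 1) (hy : u y = 0) :
    1 ≤ h.green y x x * E u u := by
  have hcs := h.sq_map_le (h.green_mem y x) hu
  rwa [h.map_green y x hu, hx, hy, sub_zero, one_pow, h.map_green_self] at hcs

variable {x y} in
theorem green_pos (hxy : x ≠ y) : 0 < h.green y x x := by
  obtain ⟨u, hu, hx, hy⟩ := h.exists_mem_eq_one_eq_zero hxy
  exact pos_of_mul_pos_left (one_pos.trans_le (h.one_le_green_mul x y hu hx hy)) (h.map_nonneg u hu)

theorem map_inv_smul_green :
    E ((h.green y x x)⁻¹ • h.green y x) ((h.green y x x)⁻¹ • h.green y x) = (h.green y x x)⁻¹ := by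
  rw [h.map_smul_smul _ (h.green_mem y x), h.map_green_self, sq]
  simpa only [inv_inv] using mul_self_mul_inv (h.green y x x)⁻¹

theorem resistance_eq_green : resistance E F x y = h.green y x x := by
  rcases eq_or_ne x y with rfl | hxy
  · rw [resistance_self, green_base]
  have hpos := h.green_pos hxy
  refine inv_injective (le_antisymm ?_ ?_)
  · rw [← h.map_inv_smul_green]
    refine inv_resistance_le h.map_nonneg (h.smul_mem _ _ (h.green_mem y x)) ?_ ?_
    · exact inv_mul_cancel₀ hpos.ne'
    · rw [Pi.smul_apply, green_base, smul_zero]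
  · refine le_inv_resistance (h.exists_mem_eq_one_eq_zero hxy) fun u hu hx hy => ?_
    rw [inv_le_iff_one_le_mul₀' hpos]
    exact h.one_le_green_mul x y hu hx hy

theorem resistance_eq_map_sub : resistance E F x y =
    E (h.green o x - h.green o y) (h.green o x - h.green o y) := by
  have hd := h.sub_mem (h.green_mem o x) (h.green_mem o y)
  have hE : ∀ u ∈ F, E (h.green o x - h.green o y) u = E (h.green y x) u := by
    intro u hu
    rw [h.map_sub_left (h.green_mem o x) (h.green_mem o y) hu]
    simp only [h.map_green _ _ hu]
    ring
  rw [resistance_eq_green, hE _ hd, h.map_symm _ (h.green_mem y x) _ hd, hE _ (h.green_mem y x),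
    h.map_green_self]

theorem green_apply :
    h.green o x y = (resistance E F x o + resistance E F y o - resistance E F x y) / 2 := by
  have hd := h.sub_mem (h.green_mem o x) (h.green_mem o y)
  rw [h.resistance_eq_map_sub o x y, h.map_sub_left (h.green_mem o x) (h.green_mem o y) hd,
    h.map_green o x hd, h.map_green o y hd, h.resistance_eq_green x o, h.resistance_eq_green y o]
  have hsymm : h.green o y x = h.green o x y := by
    have := h.map_symm _ (h.green_mem o x) _ (h.green_mem o y)
    rwa [h.map_green o x (h.green_mem o y), h.map_green o y (h.green_mem o x), green_base,
      green_base, sub_zero, sub_zero] at this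
  simp only [Pi.sub_apply, green_base, hsymm]
  ring

end Green

include h in
theorem resistance_pos {x y : X} (hxy : x ≠ y) : 0 < resistance E F x y :=
  (h.resistance_eq_green x y).symm ▸ h.green_pos hxy

include h in
theorem exists_energy_eq_inv_resistance {x y : X} (hxy : x ≠ y) :
    ∃ u ∈ F, u x = 1 ∧ u y = 0 ∧ (∀ z, u z ∈ Set.Icc (0 : ℝ) 1) ∧
      E u u = (resistance E F x y)⁻¹ := by
  set p := (h.green y x x)⁻¹ • h.green y x with hp
  have hx : p x = 1 := inv_mul_cancel₀ (h.green_pos hxy).ne'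
  have hy : p y = 0 := by rw [hp, Pi.smul_apply, green_base, smul_zero]
  have hpF : p ∈ F := h.smul_mem _ _ (h.green_mem y x)
  have hx' : clamp p x = 1 := by rw [clamp_of_mem_Icc (by simp [hx]), hx]
  have hy' : clamp p y = 0 := by rw [clamp_of_mem_Icc (by simp [hy]), hy]
  refine ⟨clamp p, h.clamp_mem hpF, hx', hy', clamp_mem_Icc p,
    le_antisymm ?_ (inv_resistance_le h.map_nonneg (h.clamp_mem hpF) hx' hy')⟩
  rw [h.resistance_eq_green, ← h.map_inv_smul_green]
  exact h.map_clamp_le hpF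

theorem map_sum_smul_green [Fintype X] (h : IsResistanceForm E Set.univ) (o : X) (a : X → ℝ)
    (v : X → ℝ) : E (∑ z, a z • h.green o z) v = ∑ z, a z * (v z - v o) := by
  have mem (u : X → ℝ) : u ∈ Set.univ := Set.mem_univ u
  simp only [h.map_sum_smul_left (fun _ _ => mem _) (mem v), h.map_green o _ (mem v)]

theorem exists_sub_const_eq_sum_smul_green [Fintype X] (h : IsResistanceForm E Set.univ) (o : X)
    (u : X → ℝ) : ∃ (a : X → ℝ) (k : ℝ), (u - fun _ => k) = ∑ z, a z • h.green o z := by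
  classical
  have mem (u : X → ℝ) : u ∈ Set.univ := Set.mem_univ u
  set w := ∑ z, E u (Pi.single z 1) • h.green o z with hw
  have huw : ∀ v, E u v = E w v := by
    intro v
    have hv : v - (fun _ => v o) = ∑ z, (v z - v o) • Pi.single z (1 : ℝ) := by
      ext x
      simp [Finset.sum_apply, Pi.single_apply]
    rw [← h.map_sub_const_right (v o) (mem u) (mem v), hv, h.map_symm u (mem u) _ (mem _),
      h.map_sum_smul_left (fun _ _ => mem _) (mem u), hw, h.map_sum_smul_green]
    exact Finset.sum_congr rfl fun z _ => by rw [h.map_symm _ (mem _) u (mem u), mul_comm]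
  have hzero : E (u - w) (u - w) = 0 := by
    rw [h.map_sub_left (mem u) (mem w) (mem _), huw, sub_self]
  obtain ⟨k, hk⟩ := (h.map_eq_zero_iff _ (mem _)).1 hzero
  refine ⟨fun z => E u (Pi.single z 1), k, ?_⟩
  rw [sub_eq_iff_eq_add', ← sub_eq_iff_eq_add]
  exact funext hk

theorem eq_of_resistance_eq [Finite X] {E' : (X → ℝ) → (X → ℝ) → ℝ}
    (h : IsResistanceForm E Set.univ) (h' : IsResistanceForm E' Set.univ)
    (hR : resistance E Set.univ = resistance E' Set.univ) : E = E' := by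
  have := Fintype.ofFinite X
  have mem (u : X → ℝ) : u ∈ Set.univ := Set.mem_univ u
  ext u v
  rcases isEmpty_or_nonempty X with hX | ⟨⟨o⟩⟩
  · obtain rfl : u = fun _ => 0 := Subsingleton.elim _ _
    rw [h.map_const_left 0 (mem v), h'.map_const_left 0 (mem v)]
  have hgreen : h.green o = h'.green o := by
    ext x y
    rw [h.green_apply, h'.green_apply, hR]
  obtain ⟨a, k, huk⟩ := h.exists_sub_const_eq_sum_smul_green o u
  rw [← h.map_sub_const_left k (mem u) (mem v), ← h'.map_sub_const_left k (mem u) (mem v), huk,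
    h.map_sum_smul_green, hgreen, h'.map_sum_smul_green]

end IsResistanceForm

/-- The closure of a set `A` of functions within `F` with respect to the energy seminorm. -/
def energyClosure {X : Type*} (E : (X → ℝ) → (X → ℝ) → ℝ) (F A : Set (X → ℝ)) : Set (X → ℝ) :=
  {u | u ∈ F ∧ ∀ ε > 0, ∃ v ∈ A, E (u - v) (u - v) < ε}

theorem energyClosure_subset {X : Type*} (E : (X → ℝ) → (X → ℝ) → ℝ) (F A : Set (X → ℝ)) :
    energyClosure E F A ⊆ F :=
  fun _ hu => hu.1

namespace IsResistanceForm

variable {X : Type*} {E : (X → ℝ) → (X → ℝ) → ℝ} {F : Set (X → ℝ)}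

section EnergyClosure

variable (h : IsResistanceForm E F) {A : Submodule ℝ (X → ℝ)} {o : X} {u : X → ℝ}

/-- The functions in `A`, viewed as a subspace of the Hilbert space of functions vanishing at
`o`. -/
noncomputable def pinnedSubmodule (A : Submodule ℝ (X → ℝ)) (o : X) : Submodule ℝ (h.Pinned o) :=
  A.comap (RKHS.coeCLM ℝ : h.Pinned o →L[ℝ] X → ℝ).toLinearMap

include h

theorem subset_energyClosure {A : Set (X → ℝ)} (hA : A ⊆ F) : A ⊆ energyClosure E F A :=
  fun u hu => ⟨hA hu, fun ε hε => ⟨u, hu, by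
    rwa [sub_self, (h.map_eq_zero_iff 0 (h.const_mem 0)).2 ⟨0, fun _ => rfl⟩]⟩⟩

theorem pin_mem_pinnedSubmodule (hconst : ∀ k : ℝ, (fun _ => k) ∈ A) (hu : u ∈ F) (huA : u ∈ A) :
    h.pin o hu ∈ h.pinnedSubmodule A o :=
  A.sub_mem huA (hconst _)

theorem mem_energyClosure_iff (hA : (A : Set (X → ℝ)) ⊆ F) (hconst : ∀ k : ℝ, (fun _ => k) ∈ A)
    (o : X) (hu : u ∈ F) : u ∈ energyClosure E F A ↔
      h.pin o hu ∈ (h.pinnedSubmodule A o).topologicalClosure := by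
  have hdist : ∀ {v} (hv : v ∈ F), dist (h.pin o hu) (h.pin o hv) = √(E (u - v) (u - v)) := by
    intro v hv
    rw [dist_eq_norm, pin_sub_pin, ← h.norm_pin_sq (o := o) (h.sub_mem hu hv),
      Real.sqrt_sq (norm_nonneg _)]
  rw [← SetLike.mem_coe, Submodule.topologicalClosure_coe, Metric.mem_closure_iff]
  constructor
  · rintro ⟨-, happrox⟩ ε hε
    obtain ⟨v, hv, huv⟩ := happrox (ε ^ 2) (by positivity)
    refine ⟨h.pin o (hA hv), h.pin_mem_pinnedSubmodule hconst _ hv, ?_⟩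
    rwa [hdist, Real.sqrt_lt' hε]
  · refine fun happrox => ⟨hu, fun ε hε => ?_⟩
    obtain ⟨f, hf, huf⟩ := happrox (√ε) (Real.sqrt_pos.2 hε)
    rw [← h.pin_coe f, hdist] at huf
    exact ⟨f, hf, (Real.sqrt_lt_sqrt_iff (h.map_nonneg _ (h.sub_mem hu f.mem))).1 huf⟩

theorem clamp_mem_energyClosure (hA : (A : Set (X → ℝ)) ⊆ F)
    (hconst : ∀ k : ℝ, (fun _ => k) ∈ A) (hclamp : ∀ u ∈ A, clamp u ∈ A) (o : X)
    (hu : u ∈ energyClosure E F A) : clamp u ∈ energyClosure E F A := by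
  obtain ⟨f, hfA, hfu⟩ :=
    mem_closure_iff_seq_limit.1 ((h.mem_energyClosure_iff hA hconst o hu.1).1 hu)
  set v : ℕ → X → ℝ := fun n => ⇑(f n) + fun _ => u o
  have hvA : ∀ n, v n ∈ A := fun n => A.add_mem (hfA n) (hconst _)
  have hvu : ∀ x, Tendsto (fun n => v n x) atTop (𝓝 (u x)) := by
    intro x
    have := (((RKHS.continuous_eval x).tendsto _).comp hfu).add_const (u o)
    simpa [v, coe_pin] using this
  obtain ⟨C, hC⟩ := hfu.norm.bddAbove_range
  have hbound : ∀ n, ‖h.pin o (hA (hclamp _ (hvA n)))‖ ≤ C := by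
    intro n
    have hpin : h.pin o (hA (hvA n)) = f n := by
      ext x
      simp only [v, coe_pin, Pi.sub_apply, Pi.add_apply, (f n).apply_base, zero_add,
        add_sub_cancel_right]
    refine le_trans ?_ (hC ⟨n, rfl⟩)
    rw [← pow_le_pow_iff_left₀ (norm_nonneg _) (norm_nonneg _) two_ne_zero, norm_pin_sq, ← hpin,
      norm_pin_sq]
    exact h.map_clamp_le (hA (hvA n))
  rw [h.mem_energyClosure_iff hA hconst o (h.clamp_mem hu.1)]
  refine mem_topologicalClosure_of_tendsto_apply (l := atTop)
    (fun n => h.pin_mem_pinnedSubmodule hconst _ (hclamp _ (hvA n))) hbound fun x => ?_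
  exact (tendsto_clamp_apply (hvu x)).sub (tendsto_clamp_apply (hvu o))

protected theorem energyClosure [Nonempty X] (hA : (A : Set (X → ℝ)) ⊆ F)
    (hconst : ∀ k : ℝ, (fun _ => k) ∈ A) (hclamp : ∀ u ∈ A, clamp u ∈ A)
    (hextend : ∀ (W : Finset X) (v : X → ℝ), ∃ u ∈ A, ∀ x ∈ W, u x = v x) :
    IsResistanceForm E (energyClosure E F A) := by
  obtain ⟨o⟩ := ‹Nonempty X›
  exact {
    const_mem k := h.subset_energyClosure hA (hconst k)
    add_mem u hu v hv := by
      have hu' := (h.mem_energyClosure_iff hA hconst o hu.1).1 hu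
      have hv' := (h.mem_energyClosure_iff hA hconst o hv.1).1 hv
      rw [h.mem_energyClosure_iff hA hconst o (h.add_mem u hu.1 v hv.1), ← h.pin_add_pin hu.1 hv.1]
      exact Submodule.add_mem _ hu' hv'
    smul_mem a u hu := by
      have hu' := (h.mem_energyClosure_iff hA hconst o hu.1).1 hu
      rw [h.mem_energyClosure_iff hA hconst o (h.smul_mem a u hu.1), ← h.smul_pin hu.1 a]
      exact Submodule.smul_mem _ a hu'
    map_add u hu v hv w hw := h.map_add u hu.1 v hv.1 w hw.1
    map_smul a u hu v hv := h.map_smul a u hu.1 v hv.1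
    map_symm u hu v hv := h.map_symm u hu.1 v hv.1
    map_nonneg u hu := h.map_nonneg u hu.1
    map_eq_zero_iff u hu := h.map_eq_zero_iff u hu.1
    complete u hu hcauchy := by
      obtain ⟨v, hv, hlim⟩ := h.complete u (fun n => (hu n).1) hcauchy
      refine ⟨v, (h.mem_energyClosure_iff hA hconst o hv).2 ?_, hlim⟩
      exact (Submodule.isClosed_topologicalClosure _).mem_of_tendsto
        ((h.tendsto_pin_iff (o := o) hv fun n => (hu n).1).2 hlim)
        (Eventually.of_forall fun n => (h.mem_energyClosure_iff hA hconst o _).1 (hu n))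
    extend W v := by
      obtain ⟨u, hu, huv⟩ := hextend W v
      exact ⟨u, h.subset_energyClosure hA hu, huv⟩
    bounded p q := by
      obtain ⟨C, hC⟩ := h.bounded p q
      exact ⟨C, fun u hu => hC u hu.1⟩
    markov u hu :=
      ⟨h.clamp_mem_energyClosure hA hconst hclamp o hu, h.map_clamp_le hu.1⟩ }

/-- An approximation of `u` within `A` can be corrected to take the value `1` at `x` exactly. -/
theorem inv_resistance_le_of_mem_energyClosure (hA : (A : Set (X → ℝ)) ⊆ F)
    (hconst : ∀ k : ℝ, (fun _ => k) ∈ A) {s : X → ℝ} {x y : X} (hs : s ∈ A) (hsx : s x = 1)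
    (hsy : s y = 0) (hu : u ∈ energyClosure E F A) (hux : u x = 1) (huy : u y = 0) :
    (resistance E (A : Set (X → ℝ)) x y)⁻¹ ≤ E u u := by
  let s' := h.pin y (hA hs)
  have hs' : ⇑s' = s := h.pin_of_apply_eq_zero _ hsy
  let Φ : h.Pinned y → h.Pinned y := fun f => f + (1 - f x) • s'
  have hclosed : IsClosed {f | (resistance E (A : Set (X → ℝ)) x y)⁻¹ ≤ ‖Φ f‖ ^ 2} := by
    have heval : Continuous fun f : h.Pinned y => f x := RKHS.continuous_eval x
    have hΦ : Continuous Φ :=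
      continuous_id.add ((continuous_const.sub heval).smul continuous_const)
    exact isClosed_le continuous_const (hΦ.norm.pow 2)
  have hcorrect : ∀ f ∈ h.pinnedSubmodule A y,
      (resistance E (A : Set (X → ℝ)) x y)⁻¹ ≤ ‖Φ f‖ ^ 2 := by
    intro f hf
    rw [Pinned.norm_sq]
    refine inv_resistance_le (fun u hu => h.map_nonneg u (hA hu)) ?_ ?_ (Pinned.apply_base _)
    · rw [RKHS.coe_add, RKHS.coe_smul, hs']
      exact A.add_mem hf (A.smul_mem _ hs)
    · simp [Φ, hs', hsx]
  have hmem := (h.mem_energyClosure_iff hA hconst y hu.1).1 hu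
  have hle : (resistance E (A : Set (X → ℝ)) x y)⁻¹ ≤ ‖Φ (h.pin y hu.1)‖ ^ 2 :=
    closure_minimal hcorrect hclosed hmem
  have hpin : ⇑(h.pin y hu.1) = u := h.pin_of_apply_eq_zero _ huy
  have hΦ : Φ (h.pin y hu.1) = h.pin y hu.1 := by
    simp [Φ, hpin, hux]
  rwa [hΦ, norm_pin_sq] at hle

theorem resistance_energyClosure (hA : (A : Set (X → ℝ)) ⊆ F)
    (hconst : ∀ k : ℝ, (fun _ => k) ∈ A)
    (hextend : ∀ (W : Finset X) (v : X → ℝ), ∃ u ∈ A, ∀ x ∈ W, u x = v x) :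
    resistance E (energyClosure E F A) = resistance E (A : Set (X → ℝ)) := by
  classical
  ext x y
  rcases eq_or_ne x y with rfl | hxy
  · rw [resistance_self, resistance_self]
  obtain ⟨s, hsA, hs⟩ := hextend {x, y} (Pi.single x 1)
  have hsx : s x = 1 := by rw [hs x (by simp), Pi.single_eq_same]
  have hsy : s y = 0 := by rw [hs y (by simp), Pi.single_eq_of_ne hxy.symm]
  have hsub := h.subset_energyClosure hA
  refine inv_injective (le_antisymm ?_ ?_)
  · refine le_inv_resistance ⟨s, hsA, hsx, hsy⟩ fun u hu hx hy => ?_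
    exact inv_resistance_le (fun u hu => h.map_nonneg u hu.1) (hsub hu) hx hy
  · refine le_inv_resistance ⟨s, hsub hsA, hsx, hsy⟩ fun u hu hx hy => ?_
    exact h.inv_resistance_le_of_mem_energyClosure hA hconst hsA hsx hsy hu hx hy

end EnergyClosure

section Harmonic

variable {u : X → ℝ}

theorem exists_harmonicExtension (h : IsResistanceForm E F) (W : Finset X) (f : W → ℝ) :
    ∃ u ∈ F, (∀ x : W, u x = f x) ∧ ∀ v ∈ F, (∀ x : W, v x = 0) → E u v = 0 := by
  obtain ⟨u, hu, huf⟩ := h.extend W (Function.extend Subtype.val f 0)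
  have huf' : ∀ x : W, u x = f x := fun x => by
    rw [huf x x.2, Subtype.val_injective.extend_apply]
  rcases W.eq_empty_or_nonempty with rfl | ⟨o, ho⟩
  · exact ⟨0, h.const_mem 0, by simp, fun v hv _ => h.map_const_left 0 hv⟩
  let M : Submodule ℝ (h.Pinned o) :=
    { carrier := {g | ∀ x : W, g x = 0}
      zero_mem' := fun x => by simp
      add_mem' := fun hg hg' x => by simp [hg x, hg' x]
      smul_mem' := fun a g hg x => by simp [hg x] }
  have hM : (M : Set (h.Pinned o)) = ⋂ x : W, {g | g x = 0} := by
    ext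
    simp [M]
  have hclosed : IsClosed (M : Set (h.Pinned o)) :=
    hM ▸ isClosed_iInter fun x => isClosed_eq (RKHS.continuous_eval _) continuous_const
  have := hclosed.completeSpace_coe
  set q := M.starProjection (h.pin o hu)
  refine ⟨u - q, h.sub_mem hu q.mem, fun x => ?_, fun v hv hvW => ?_⟩
  · have hqx : q x = 0 := M.starProjection_apply_mem _ x
    rw [Pi.sub_apply, hqx, sub_zero, huf' x]
  · have hvM : h.pin o hv ∈ M := fun x => by
      rw [h.pin_of_apply_eq_zero hv (hvW ⟨o, ho⟩), hvW x]
    rw [h.map_sub_left hu q.mem hv, ← h.inner_pin_pin (o := o) hu hv, ← h.inner_pin_right hv,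
      ← inner_sub_left]
    exact M.starProjection_inner_eq_zero _ _ hvM

variable (h : IsResistanceForm E F) {W : Finset X} (f g : W → ℝ) {x y : W}

/-- The harmonic extension of a function on a finite set `W`: the function of least energy with
the given values on `W`. -/
noncomputable def harmonicExtension : X → ℝ := (h.exists_harmonicExtension W f).choose

theorem harmonicExtension_mem : h.harmonicExtension f ∈ F :=
  (h.exists_harmonicExtension W f).choose_spec.1

theorem harmonicExtension_apply (x : W) : h.harmonicExtension f x = f x :=
  (h.exists_harmonicExtension W f).choose_spec.2.1 x

theorem map_harmonicExtension_congr (hu : u ∈ F) (hv : v ∈ F) (huv : ∀ x : W, u x = v x) :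
    E (h.harmonicExtension f) u = E (h.harmonicExtension f) v := by
  rw [← sub_eq_zero, ← h.map_sub_right (h.harmonicExtension_mem f) hu hv]
  exact (h.exists_harmonicExtension W f).choose_spec.2.2 _ (h.sub_mem hu hv)
    fun x => by rw [Pi.sub_apply, huv, sub_self]

variable {f} in
theorem map_self_eq_harmonicExtension_add (hu : u ∈ F) (huf : ∀ x : W, u x = f x) :
    E u u = E (h.harmonicExtension f) (h.harmonicExtension f) +
      E (u - h.harmonicExtension f) (u - h.harmonicExtension f) := by
  have hH := h.harmonicExtension_mem f
  refine h.map_self_eq_add_of_orthogonal hu hH ?_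
  rw [h.map_sub_right hH hu hH, sub_eq_zero]
  exact h.map_harmonicExtension_congr f hu hH fun x => by rw [huf, h.harmonicExtension_apply]

variable {f} in
theorem map_harmonicExtension_le (hu : u ∈ F) (huf : ∀ x : W, u x = f x) :
    E (h.harmonicExtension f) (h.harmonicExtension f) ≤ E u u :=
  h.map_self_eq_harmonicExtension_add hu huf ▸
    le_add_of_nonneg_right (h.map_nonneg _ (h.sub_mem hu (h.harmonicExtension_mem f)))

variable {f} in
theorem harmonicExtension_mem_Icc [Nonempty W] (hf : ∀ x, f x ∈ Set.Icc (0 : ℝ) 1) (z : X) :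
    h.harmonicExtension f z ∈ Set.Icc (0 : ℝ) 1 := by
  set H := h.harmonicExtension f
  have hH : H ∈ F := h.harmonicExtension_mem f
  have hHf : ∀ x : W, H x = f x := h.harmonicExtension_apply f
  have hW : ∀ x : W, clamp H x = f x := fun x => by
    rw [clamp_of_mem_Icc (hHf x ▸ hf x), hHf]
  have hzero : E (clamp H - H) (clamp H - H) = 0 := by
    refine le_antisymm ?_ (h.map_nonneg _ (h.sub_mem (h.clamp_mem hH) hH))
    have := h.map_self_eq_harmonicExtension_add (h.clamp_mem hH) hW
    have := h.map_clamp_le hH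
    linarith
  obtain ⟨k, hk⟩ := (h.map_eq_zero_iff _ (h.sub_mem (h.clamp_mem hH) hH)).1 hzero
  obtain ⟨x⟩ := ‹Nonempty W›
  have hk0 : k = 0 := by
    rw [← hk x, Pi.sub_apply, hW x, hHf x, sub_self]
  rw [← sub_eq_zero.1 ((hk z).trans hk0)]
  exact clamp_mem_Icc H z

open Classical in
/-- The harmonic extension of the indicator function of the point `x` of `W`. -/
noncomputable def harmonicIndicator (x : W) : X → ℝ := h.harmonicExtension (Pi.single x 1)

theorem harmonicIndicator_mem (x : W) : h.harmonicIndicator x ∈ F :=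
  h.harmonicExtension_mem _

theorem harmonicIndicator_self (x : W) : h.harmonicIndicator x x = 1 := by
  classical
  exact (h.harmonicExtension_apply _ x).trans (Pi.single_eq_same x 1)

theorem harmonicIndicator_of_ne (hxy : x ≠ y) : h.harmonicIndicator x y = 0 := by
  classical
  exact (h.harmonicExtension_apply _ y).trans (Pi.single_eq_of_ne hxy.symm 1)

theorem harmonicIndicator_mem_Icc (x : W) (z : X) :
    h.harmonicIndicator x z ∈ Set.Icc (0 : ℝ) 1 := by
  classical
  have := Nonempty.intro x
  refine h.harmonicExtension_mem_Icc (fun y => ?_) z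
  rcases eq_or_ne x y with rfl | hxy
  · simp
  · simp [Pi.single_eq_of_ne hxy.symm]

theorem sum_smul_harmonicIndicator_apply (x : W) :
    (∑ y, f y • h.harmonicIndicator y : X → ℝ) x = f x := by
  rw [Finset.sum_apply, Finset.sum_eq_single x]
  · rw [Pi.smul_apply, harmonicIndicator_self, smul_eq_mul, mul_one]
  · intro y _ hyx
    rw [Pi.smul_apply, h.harmonicIndicator_of_ne hyx, smul_zero]
  · simp

theorem map_harmonicExtension_eq_sum (hu : u ∈ F) (huf : ∀ x : W, u x = f x) :
    E (h.harmonicExtension g) u = ∑ x, f x * E (h.harmonicIndicator x) (h.harmonicExtension g) := by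
  have hmem := fun (x : W) (_ : x ∈ Finset.univ) => h.harmonicIndicator_mem x
  rw [h.map_harmonicExtension_congr g hu (h.sum_smul_mem (a := f) hmem)
      fun x => by rw [huf, sum_smul_harmonicIndicator_apply],
    h.map_symm _ (h.harmonicExtension_mem g) _ (h.sum_smul_mem hmem),
    h.map_sum_smul_left hmem (h.harmonicExtension_mem g)]

theorem sum_map_harmonicIndicator (x : W) :
    ∑ y : W, E (h.harmonicIndicator y) (h.harmonicIndicator x) = 0 := by
  classical
  have := h.map_harmonicExtension_eq_sum (fun _ => 1) (Pi.single x 1) (h.const_mem 1) fun _ => rfl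
  rw [h.map_const_right 1 (h.harmonicExtension_mem _)] at this
  simp only [one_mul] at this
  exact this.symm

theorem map_harmonicExtension_harmonicExtension :
    E (h.harmonicExtension f) (h.harmonicExtension g) =
      ∑ x, ∑ y, f x * g y * E (h.harmonicIndicator x) (h.harmonicIndicator y) := by
  have hHf := h.harmonicExtension_mem f
  have hHg := h.harmonicExtension_mem g
  rw [h.map_symm _ hHf _ hHg, h.map_harmonicExtension_eq_sum f g hHf (h.harmonicExtension_apply f)]
  refine Finset.sum_congr rfl fun x _ => ?_
  rw [harmonicIndicator, h.map_harmonicExtension_eq_sum g _ hHg (h.harmonicExtension_apply g),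
    Finset.mul_sum]
  refine Finset.sum_congr rfl fun y _ => ?_
  rw [mul_assoc, h.map_symm _ (h.harmonicIndicator_mem y) _ (h.harmonicExtension_mem _)]

theorem clamp_harmonicIndicator_sub_smul (hxy : x ≠ y) {t : ℝ} (ht : 0 ≤ t) (z : W) :
    clamp (h.harmonicIndicator x - t • h.harmonicIndicator y) z = h.harmonicIndicator x z := by
  rcases eq_or_ne y z with rfl | hyz
  · rw [h.harmonicIndicator_of_ne hxy]
    refine clamp_of_nonpos ?_
    simpa [h.harmonicIndicator_of_ne hxy, h.harmonicIndicator_self] using ht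
  · have hval : (h.harmonicIndicator x - t • h.harmonicIndicator y) z =
        h.harmonicIndicator x z := by simp [h.harmonicIndicator_of_ne hyz]
    rw [clamp_of_mem_Icc (hval ▸ h.harmonicIndicator_mem_Icc x z), hval]

theorem map_harmonicIndicator_nonpos (hxy : x ≠ y) :
    E (h.harmonicIndicator x) (h.harmonicIndicator y) ≤ 0 := by
  have hx := h.harmonicIndicator_mem x
  have hy := h.harmonicIndicator_mem y
  refine h.map_nonpos_of_forall_map_le hx hy fun t ht => ?_
  have hsub := h.sub_mem hx (h.smul_mem t _ hy)
  refine le_trans (h.map_harmonicExtension_le (h.clamp_mem hsub) fun z => ?_) (h.map_clamp_le hsub)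
  rw [h.clamp_harmonicIndicator_sub_smul hxy ht.le, harmonicIndicator, harmonicExtension_apply]

end Harmonic
end IsResistanceForm

section FiniteFunctions

/-- The functions that are constant outside a finite set, as a linear subspace of all functions. -/
def finiteSubmodule (V : Type*) : Submodule ℝ (V → ℝ) where
  carrier := finiteFunctions V
  zero_mem' := ⟨0, ∅, fun _ _ => rfl⟩
  add_mem' := by
    classical
    rintro u v ⟨k, S, hu⟩ ⟨l, T, hv⟩
    refine ⟨k + l, S ∪ T, fun x hx => ?_⟩
    rw [Finset.mem_union, not_or] at hx
    rw [Pi.add_apply, hu x hx.1, hv x hx.2]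
  smul_mem' := by
    rintro a u ⟨k, S, hu⟩
    exact ⟨a * k, S, fun x hx => by rw [Pi.smul_apply, hu x hx, smul_eq_mul]⟩

variable {V : Type*}

theorem const_mem_finiteFunctions (k : ℝ) : (fun _ => k) ∈ finiteFunctions V :=
  ⟨k, ∅, fun _ _ => rfl⟩

theorem clamp_mem_finiteFunctions {u : V → ℝ} (hu : u ∈ finiteFunctions V) :
    clamp u ∈ finiteFunctions V := by
  obtain ⟨k, S, hS⟩ := hu
  exact ⟨min 1 (max k 0), S, fun x hx => by rw [clamp, hS x hx]⟩

theorem exists_mem_finiteFunctions_eq (W : Finset V) (v : V → ℝ) :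
    ∃ u ∈ finiteFunctions V, ∀ x ∈ W, u x = v x := by
  classical
  exact ⟨fun x => if x ∈ W then v x else 0, ⟨0, W, fun _ hx => if_neg hx⟩, fun _ hx => if_pos hx⟩

theorem single_mem_finiteFunctions [DecidableEq V] (y : V) :
    (Pi.single y 1 : V → ℝ) ∈ finiteFunctions V :=
  ⟨0, {y}, fun _ hx => Pi.single_eq_of_ne (Finset.notMem_singleton.1 hx) 1⟩

end FiniteFunctions

section PairSums

variable {ι : Type*} [DecidableEq ι] {f : ι → ℝ} {a : ℝ}

theorem hasSum_ite_fst_eq (y : ι) (hf : HasSum f a) :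
    HasSum (fun p : ι × ι => if p.1 = y then f p.2 else 0) a := by
  refine ((Prod.mk_right_injective y).hasSum_iff ?_).1 (by simpa [Function.comp_def] using hf)
  rintro ⟨x, z⟩ hxz
  exact if_neg fun hx : x = y => hxz ⟨z, by rw [hx]⟩

theorem hasSum_ite_snd_eq (y : ι) (hf : HasSum f a) :
    HasSum (fun p : ι × ι => if p.2 = y then f p.1 else 0) a :=
  (Equiv.prodComm ι ι).hasSum_iff.1 (hasSum_ite_fst_eq y hf)

end PairSums

namespace WeightedGraph

variable {V : Type*} {G : WeightedGraph V} {u v w : V → ℝ}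

section Energy

theorem energyForm_self (u : V → ℝ) :
    G.energyForm u u = 1 / 2 * ∑' p : V × V, G.c p.1 p.2 * (u p.1 - u p.2) ^ 2 := by
  simp only [energyForm, mul_assoc, sq]

theorem energyForm_comm (u v : V → ℝ) : G.energyForm u v = G.energyForm v u := by
  simp only [energyForm, mul_right_comm]

theorem energy_term_nonneg (u : V → ℝ) (p : V × V) : 0 ≤ G.c p.1 p.2 * (u p.1 - u p.2) ^ 2 :=
  mul_nonneg (G.nonneg _ _) (sq_nonneg _)

theorem energyForm_self_nonneg (u : V → ℝ) : 0 ≤ G.energyForm u u := by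
  rw [energyForm_self]
  exact mul_nonneg one_half_pos.le (tsum_nonneg (energy_term_nonneg u))

theorem energyForm_const_left (k : ℝ) (u : V → ℝ) : G.energyForm (fun _ => k) u = 0 := by
  simp [energyForm]

theorem sum_le_two_mul_energyForm (hu : u ∈ G.domE) (S : Finset (V × V)) :
    ∑ p ∈ S, G.c p.1 p.2 * (u p.1 - u p.2) ^ 2 ≤ 2 * G.energyForm u u := by
  have := hu.sum_le_tsum S fun p _ => energy_term_nonneg u p
  linarith [G.energyForm_self u]

theorem mem_domE_of_sum_le {a : ℝ}
    (h : ∀ S : Finset (V × V), ∑ p ∈ S, G.c p.1 p.2 * (u p.1 - u p.2) ^ 2 ≤ 2 * a) :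
    u ∈ G.domE ∧ G.energyForm u u ≤ a := by
  have hu : u ∈ G.domE := summable_of_sum_le (energy_term_nonneg u) h
  have := hu.tsum_le_of_sum_le h
  exact ⟨hu, by linarith [G.energyForm_self u]⟩

theorem mem_domE_of_tendsto {ι : Type*} {l : Filter ι} [l.NeBot] {f : ι → V → ℝ} {e : ι → ℝ}
    {a : ℝ} (hf : ∀ x, Tendsto (fun i => f i x) l (𝓝 (u x))) (he : Tendsto e l (𝓝 a))
    (h : ∀ S : Finset (V × V),
      ∀ᶠ i in l, ∑ p ∈ S, G.c p.1 p.2 * (f i p.1 - f i p.2) ^ 2 ≤ 2 * e i) :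
    u ∈ G.domE ∧ G.energyForm u u ≤ a :=
  mem_domE_of_sum_le fun S => le_of_tendsto_of_tendsto
    (tendsto_finsetSum S fun p _ => (((hf p.1).sub (hf p.2)).pow 2).const_mul _)
    (he.const_mul 2) (h S)

theorem const_mem_domE (k : ℝ) : (fun _ => k) ∈ G.domE := by
  simp [domE, summable_zero]

theorem smul_mem_domE (a : ℝ) (hu : u ∈ G.domE) : a • u ∈ G.domE := by
  refine (hu.mul_left (a ^ 2)).congr fun p => ?_
  simp only [Pi.smul_apply, smul_eq_mul]
  ring

theorem add_mem_domE (hu : u ∈ G.domE) (hv : v ∈ G.domE) : u + v ∈ G.domE := by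
  refine ((Summable.add hu hv).mul_left 2).of_nonneg_of_le (energy_term_nonneg _) fun p => ?_
  rw [← mul_add, mul_left_comm]
  refine mul_le_mul_of_nonneg_left ?_ (G.nonneg _ _)
  calc ((u + v) p.1 - (u + v) p.2) ^ 2 = ((u p.1 - u p.2) + (v p.1 - v p.2)) ^ 2 := by
        simp only [Pi.add_apply]
        ring
    _ ≤ 2 * ((u p.1 - u p.2) ^ 2 + (v p.1 - v p.2) ^ 2) := add_sq_le

theorem sub_mem_domE (hu : u ∈ G.domE) (hv : v ∈ G.domE) : u - v ∈ G.domE := by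
  simpa only [neg_one_smul, ← sub_eq_add_neg] using add_mem_domE hu (smul_mem_domE (-1) hv)

theorem summable_energyForm (hu : u ∈ G.domE) (hv : v ∈ G.domE) :
    Summable fun p : V × V => G.c p.1 p.2 * (u p.1 - u p.2) * (v p.1 - v p.2) := by
  refine ((((add_mem_domE hu hv).sub hu).sub hv).mul_left (1 / 2)).congr fun p => ?_
  simp only [Pi.add_apply]
  ring

theorem energyForm_add_left (hu : u ∈ G.domE) (hv : v ∈ G.domE) (hw : w ∈ G.domE) :
    G.energyForm (u + v) w = G.energyForm u w + G.energyForm v w := by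
  simp only [energyForm]
  rw [← mul_add, ← (summable_energyForm hu hw).tsum_add (summable_energyForm hv hw)]
  refine congrArg _ (tsum_congr fun p => ?_)
  simp only [Pi.add_apply]
  ring

theorem energyForm_smul_left (a : ℝ) (u v : V → ℝ) :
    G.energyForm (a • u) v = a * G.energyForm u v := by
  simp only [energyForm]
  rw [mul_left_comm, ← tsum_mul_left (a := a)]
  refine congrArg _ (tsum_congr fun p => ?_)
  simp only [Pi.smul_apply, smul_eq_mul]
  ring

theorem sum_smul_mem_domE {ι : Type*} {s : Finset ι} {a : ι → ℝ} {f : ι → V → ℝ}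
    (hf : ∀ i, f i ∈ G.domE) : ∑ i ∈ s, a i • f i ∈ G.domE :=
  Finset.sum_induction _ (· ∈ G.domE) (fun _ _ => add_mem_domE) (const_mem_domE 0)
    fun i _ => smul_mem_domE (a i) (hf i)

theorem energyForm_sum_smul_left {ι : Type*} {s : Finset ι} {a : ι → ℝ} {f : ι → V → ℝ}
    (hf : ∀ i, f i ∈ G.domE) (hv : v ∈ G.domE) :
    G.energyForm (∑ i ∈ s, a i • f i) v = ∑ i ∈ s, a i * G.energyForm (f i) v := by
  classical
  induction s using Finset.induction_on with
  | empty => exact energyForm_const_left 0 v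
  | insert i s hi ih =>
    rw [Finset.sum_insert hi, Finset.sum_insert hi,
      energyForm_add_left (smul_mem_domE _ (hf i)) (sum_smul_mem_domE hf) hv,
      energyForm_smul_left, ih]

theorem clamp_term_le (u : V → ℝ) (p : V × V) :
    G.c p.1 p.2 * (clamp u p.1 - clamp u p.2) ^ 2 ≤ G.c p.1 p.2 * (u p.1 - u p.2) ^ 2 :=
  mul_le_mul_of_nonneg_left (sq_le_sq.2 (abs_clamp_sub_clamp_le u _ _)) (G.nonneg _ _)

theorem clamp_mem_domE (hu : u ∈ G.domE) : clamp u ∈ G.domE :=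
  Summable.of_nonneg_of_le (energy_term_nonneg _) (clamp_term_le u) hu

theorem energyForm_clamp_le (hu : u ∈ G.domE) :
    G.energyForm (clamp u) (clamp u) ≤ G.energyForm u u := by
  rw [energyForm_self, energyForm_self]
  exact mul_le_mul_of_nonneg_left ((clamp_mem_domE hu).tsum_le_tsum (clamp_term_le u) hu)
    one_half_pos.le

theorem exists_sq_sub_le (hconn : G.Connected) (x y : V) :
    ∃ C : ℝ, ∀ u ∈ G.domE, (u x - u y) ^ 2 ≤ C * G.energyForm u u := by
  obtain ⟨walk⟩ := hconn.preconnected x y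
  induction walk with
  | nil => exact ⟨0, fun u _ => by simp⟩
  | @cons x z y hxz _ ih =>
    obtain ⟨C, hC⟩ := ih
    have hc : 0 < G.c x z := hxz
    refine ⟨2 * (2 / G.c x z + C), fun u hu => ?_⟩
    have hterm : (u x - u z) ^ 2 ≤ 2 / G.c x z * G.energyForm u u := by
      rw [div_mul_eq_mul_div, le_div_iff₀ hc, mul_comm]
      simpa using sum_le_two_mul_energyForm hu {(x, z)}
    calc (u x - u y) ^ 2 = ((u x - u z) + (u z - u y)) ^ 2 := by rw [sub_add_sub_cancel]
      _ ≤ 2 * ((u x - u z) ^ 2 + (u z - u y) ^ 2) := add_sq_le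
      _ ≤ 2 * (2 / G.c x z + C) * G.energyForm u u := by linarith [hC u hu]

theorem energyForm_self_eq_zero_iff (hconn : G.Connected) (hu : u ∈ G.domE) :
    G.energyForm u u = 0 ↔ ∃ k, ∀ x, u x = k := by
  constructor
  · intro hzero
    obtain ⟨o⟩ := hconn.nonempty
    refine ⟨u o, fun x => ?_⟩
    obtain ⟨C, hC⟩ := exists_sq_sub_le hconn x o
    have := hC u hu
    rw [hzero, mul_zero] at this
    exact sub_eq_zero.1 (pow_eq_zero_iff two_ne_zero |>.1 (this.antisymm (sq_nonneg _)))
  · rintro ⟨k, hk⟩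
    rw [show u = fun _ => k from funext hk, energyForm_const_left]

theorem cauchySeq_apply_sub (hconn : G.Connected) {f : ℕ → V → ℝ} (hf : ∀ n, f n ∈ G.domE)
    (hcauchy : ∀ ε > 0, ∃ N, ∀ m ≥ N, ∀ n ≥ N, G.energyForm (f m - f n) (f m - f n) < ε)
    (x o : V) : CauchySeq fun n => f n x - f n o := by
  obtain ⟨C, hC⟩ := exists_sq_sub_le hconn x o
  refine Metric.cauchySeq_iff.2 fun ε hε => ?_
  obtain ⟨N, hN⟩ := hcauchy (ε ^ 2 / (|C| + 1)) (by positivity)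
  refine ⟨N, fun m hm n hn => abs_lt_of_sq_lt_sq ?_ hε.le⟩
  have hlt := hN m hm n hn
  rw [lt_div_iff₀ (by positivity)] at hlt
  calc (f m x - f m o - (f n x - f n o)) ^ 2 = ((f m - f n) x - (f m - f n) o) ^ 2 := by
        simp only [Pi.sub_apply]
        ring
    _ ≤ C * G.energyForm (f m - f n) (f m - f n) := hC _ (sub_mem_domE (hf m) (hf n))
    _ ≤ (|C| + 1) * G.energyForm (f m - f n) (f m - f n) :=
        mul_le_mul_of_nonneg_right (by linarith [le_abs_self C]) (energyForm_self_nonneg _)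
    _ < ε ^ 2 := by linarith

theorem domE_complete (hconn : G.Connected) (f : ℕ → V → ℝ) (hf : ∀ n, f n ∈ G.domE)
    (hcauchy : ∀ ε > 0, ∃ N, ∀ m ≥ N, ∀ n ≥ N, G.energyForm (f m - f n) (f m - f n) < ε) :
    ∃ v ∈ G.domE, Tendsto (fun n => G.energyForm (f n - v) (f n - v)) atTop (𝓝 0) := by
  obtain ⟨o⟩ := hconn.nonempty
  choose v hv using fun x =>
    cauchySeq_tendsto_of_complete (cauchySeq_apply_sub hconn hf hcauchy x o)
  have hclose : ∀ ε > 0, ∃ N, ∀ n ≥ N, f n - v ∈ G.domE ∧ G.energyForm (f n - v) (f n - v) ≤ ε := by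
    intro ε hε
    obtain ⟨N, hN⟩ := hcauchy ε hε
    refine ⟨N, fun n hn => mem_domE_of_tendsto (l := atTop)
      (f := fun m x => f n x - (f m x - f m o)) (fun x => tendsto_const_nhds.sub (hv x))
      tendsto_const_nhds fun S => ?_⟩
    filter_upwards [eventually_ge_atTop N] with m hm
    calc ∑ p ∈ S, G.c p.1 p.2 *
          (f n p.1 - (f m p.1 - f m o) - (f n p.2 - (f m p.2 - f m o))) ^ 2
        = ∑ p ∈ S, G.c p.1 p.2 * ((f n - f m) p.1 - (f n - f m) p.2) ^ 2 := by
          refine Finset.sum_congr rfl fun p _ => ?_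
          simp only [Pi.sub_apply]
          ring
      _ ≤ 2 * G.energyForm (f n - f m) (f n - f m) :=
          sum_le_two_mul_energyForm (sub_mem_domE (hf n) (hf m)) S
      _ ≤ 2 * ε := by linarith [hN n hn m hm]
  refine ⟨v, ?_, ?_⟩
  · obtain ⟨N, hN⟩ := hclose 1 one_pos
    simpa only [sub_sub_cancel] using sub_mem_domE (hf N) (hN N le_rfl).1
  · refine Metric.tendsto_atTop.2 fun ε hε => ?_
    obtain ⟨N, hN⟩ := hclose (ε / 2) (half_pos hε)
    refine ⟨N, fun n hn => ?_⟩
    rw [Real.dist_eq, sub_zero, abs_of_nonneg (energyForm_self_nonneg _)]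
    linarith [(hN n hn).2]

end Energy

theorem totalWeight_pos [Nontrivial V] (hconn : G.Connected) (hfin : G.LocallyFinite) (z : V) :
    0 < G.totalWeight z := by
  obtain ⟨y, hzy⟩ := hconn.preconnected.exists_adj_of_nontrivial z
  exact (hfin z).tsum_pos (G.nonneg z) y hzy

section PointMass

variable [DecidableEq V]

theorem single_mem_domE (hfin : G.LocallyFinite) (y : V) : (Pi.single y 1 : V → ℝ) ∈ G.domE := by
  have hsum := (hasSum_ite_fst_eq y (hfin y).hasSum).summable.add
    (hasSum_ite_snd_eq y (hfin y).hasSum).summable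
  refine hsum.of_nonneg_of_le (energy_term_nonneg _) ?_
  rintro ⟨x, z⟩
  have := G.nonneg y x
  have := G.nonneg y z
  have := G.symm y x
  by_cases hx : x = y <;> by_cases hz : z = y <;> simp_all [G.diag]

theorem energyForm_single_of_hasSum {y : V} {a : ℝ}
    (ha : HasSum (fun z => G.c y z * (u y - u z)) a) : G.energyForm u (Pi.single y 1) = a := by
  have hterm : ∀ p : V × V, G.c p.1 p.2 * (u p.1 - u p.2) *
      ((Pi.single y 1 : V → ℝ) p.1 - (Pi.single y 1 : V → ℝ) p.2) =
      (if p.1 = y then G.c y p.2 * (u y - u p.2) else 0) +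
        (if p.2 = y then G.c y p.1 * (u y - u p.1) else 0) := by
    rintro ⟨x, z⟩
    have := G.symm y x
    by_cases hx : x = y <;> by_cases hz : z = y <;> simp_all [G.diag]
    ring
  rw [energyForm, tsum_congr hterm,
    ((hasSum_ite_fst_eq y ha).add (hasSum_ite_snd_eq y ha)).tsum_eq]
  ring

theorem energyForm_single (hfin : G.LocallyFinite) {y : V}
    (hu : Summable fun z => G.c y z * u z) :
    G.energyForm u (Pi.single y 1) = G.totalWeight y * u y - ∑' z, G.c y z * u z := by
  refine energyForm_single_of_hasSum ?_
  simpa only [mul_sub, totalWeight] using ((hfin y).hasSum.mul_right (u y)).sub hu.hasSum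

theorem energyForm_single_single (hfin : G.LocallyFinite) {x y : V} (hxy : x ≠ y) :
    G.energyForm (Pi.single x 1) (Pi.single y 1) = -G.c x y := by
  have hsum : HasSum (fun z => G.c y z * (Pi.single x 1 : V → ℝ) z) (G.c y x) := by
    simpa using hasSum_single (f := fun z => G.c y z * (Pi.single x 1 : V → ℝ) z) x
      fun z hz => by simp [hz]
  rw [energyForm_single hfin hsum.summable, hsum.tsum_eq, Pi.single_eq_of_ne hxy.symm, G.symm y x,
    mul_zero, zero_sub]

theorem energyForm_single_eq_totalWeight_mul_laplacian [Nontrivial V] (hconn : G.Connected)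
    (hfin : G.LocallyFinite) {z : V} (hu : Summable fun y => G.c z y * u y) :
    G.energyForm u (Pi.single z 1) = G.totalWeight z * G.laplacian u z := by
  have hz := (totalWeight_pos hconn hfin z).ne'
  rw [energyForm_single hfin hu, laplacian, mul_sub, ← tsum_mul_left]
  refine congrArg _ (tsum_congr fun y => ?_)
  field_simp

end PointMass

section FiniteFunctions

theorem eq_const_add_sum_smul_single [DecidableEq V] {k : ℝ} {W : Finset V}
    (hu : ∀ x, x ∉ W → u x = k) :
    u = (fun _ => k) + ∑ y ∈ W, (u y - k) • (Pi.single y 1 : V → ℝ) := by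
  ext x
  simp only [Pi.add_apply, Finset.sum_apply, Pi.smul_apply, Pi.single_apply, smul_eq_mul,
    mul_ite, mul_one, mul_zero, Finset.sum_ite_eq]
  split_ifs with hx
  · ring
  · rw [hu x hx, add_zero]

theorem finiteFunctions_subset_domE (hfin : G.LocallyFinite) : finiteFunctions V ⊆ G.domE := by
  classical
  rintro u ⟨k, W, hu⟩
  rw [eq_const_add_sum_smul_single hu]
  exact add_mem_domE (const_mem_domE k) (sum_smul_mem_domE fun y => single_mem_domE hfin y)

theorem isResistanceForm_domE (hconn : G.Connected) (hfin : G.LocallyFinite) :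
    IsResistanceForm G.energyForm G.domE where
  const_mem := const_mem_domE
  add_mem _ hu _ hv := add_mem_domE hu hv
  smul_mem a _ hu := smul_mem_domE a hu
  map_add _ hu _ hv _ hw := energyForm_add_left hu hv hw
  map_smul a u _ v _ := energyForm_smul_left a u v
  map_symm u _ v _ := energyForm_comm u v
  map_nonneg u _ := energyForm_self_nonneg u
  map_eq_zero_iff _ hu := energyForm_self_eq_zero_iff hconn hu
  complete := domE_complete hconn
  extend W v := by
    obtain ⟨u, hu, huv⟩ := exists_mem_finiteFunctions_eq W v
    exact ⟨u, finiteFunctions_subset_domE hfin hu, huv⟩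
  bounded := exists_sq_sub_le hconn
  markov _ hu := ⟨clamp_mem_domE hu, energyForm_clamp_le hu⟩

theorem energyForm_eq_sum_of_eq_const [DecidableEq V] (hfin : G.LocallyFinite) (hw : w ∈ G.domE)
    {k : ℝ} {W : Finset V} (hu : ∀ x, x ∉ W → u x = k) :
    G.energyForm w u = ∑ y ∈ W, (u y - k) * G.energyForm w (Pi.single y 1) := by
  have hsingle := fun y => single_mem_domE hfin y
  rw [energyForm_comm, eq_const_add_sum_smul_single hu,
    energyForm_add_left (const_mem_domE k) (sum_smul_mem_domE hsingle) hw, energyForm_const_left,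
    energyForm_sum_smul_left hsingle hw, zero_add]
  simp only [← eq_const_add_sum_smul_single hu, energyForm_comm w]

end FiniteFunctions

theorem effectiveResistance_self (K : WeightedGraph V) (x : V) :
    K.effectiveResistance x x = 0 := by
  unfold effectiveResistance
  split_ifs with hφ
  · exact hφ.choose_spec.2
  · rfl

section Finite

variable [Finite V] {K : WeightedGraph V} {x y : V}

theorem locallyFinite_of_finite (K : WeightedGraph V) : K.LocallyFinite :=
  fun _ => Summable.of_finite

theorem domE_eq_univ (K : WeightedGraph V) : K.domE = Set.univ :=
  Set.eq_univ_of_forall fun _ => Summable.of_finite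

theorem isResistanceForm_univ (hK : K.Connected) : IsResistanceForm K.energyForm Set.univ :=
  K.domE_eq_univ ▸ isResistanceForm_domE hK K.locallyFinite_of_finite

theorem isDirichletSolution_iff [Nontrivial V] (hK : K.Connected) {φ : V → ℝ} :
    K.IsDirichletSolution x y φ ↔ (∀ v, K.energyForm φ v = v x - v y) ∧ φ y = 0 := by
  classical
  have := Fintype.ofFinite V
  refine and_congr_left fun _ => ?_
  have hlap : ∀ z, K.laplacian φ z = (if z = x then 1 / K.totalWeight x else 0) -
      (if z = y then 1 / K.totalWeight y else 0) ↔ K.energyForm φ (Pi.single z 1) =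
        (Pi.single z 1 : V → ℝ) x - (Pi.single z 1 : V → ℝ) y := by
    intro z
    have hz := (totalWeight_pos hK K.locallyFinite_of_finite z).ne'
    rw [energyForm_single_eq_totalWeight_mul_laplacian hK K.locallyFinite_of_finite
      Summable.of_finite, ← mul_right_inj' hz]
    refine Eq.congr rfl ?_
    by_cases hx : z = x <;> by_cases hy : z = y <;> subst_vars <;> simp_all
  simp only [hlap]
  refine ⟨fun hsingle v => ?_, fun hall z => hall _⟩
  rw [energyForm_eq_sum_of_eq_const K.locallyFinite_of_finite (K.domE_eq_univ ▸ Set.mem_univ φ)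
    (k := 0) fun z hz => absurd (Finset.mem_univ z) hz]
  simp [hsingle, mul_sub, Pi.single_apply]

theorem effectiveResistance_eq_resistance (hK : K.Connected) (x y : V) :
    K.effectiveResistance x y = resistance K.energyForm Set.univ x y := by
  rcases eq_or_ne x y with rfl | hxy
  · rw [effectiveResistance_self, resistance_self]
  have := nontrivial_of_ne x y hxy
  have h := isResistanceForm_univ hK
  have hex : ∃ φ, K.IsDirichletSolution x y φ := ⟨h.green y x, (isDirichletSolution_iff hK).2
    ⟨fun v => h.map_green y x (Set.mem_univ v), h.green_base y x⟩⟩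
  obtain ⟨hφ, hφy⟩ := (isDirichletSolution_iff hK).1 hex.choose_spec
  have hgreen := h.map_green y x (Set.mem_univ hex.choose)
  rw [energyForm_comm, hφ, hφy, h.green_base, sub_zero, sub_zero] at hgreen
  rw [effectiveResistance, dif_pos hex, h.resistance_eq_green, hgreen]

theorem eq_of_effectiveResistance_eq {K' : WeightedGraph V} (hK : K.Connected)
    (hK' : K'.Connected)
    (hR : ∀ x y, K.effectiveResistance x y = K'.effectiveResistance x y) : K = K' := by
  classical
  have hE : K.energyForm = K'.energyForm :=
    (isResistanceForm_univ hK).eq_of_resistance_eq (isResistanceForm_univ hK') <| by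
      ext x y
      rw [← effectiveResistance_eq_resistance hK, ← effectiveResistance_eq_resistance hK', hR]
  ext x y
  rcases eq_or_ne x y with rfl | hxy
  · rw [K.diag, K'.diag]
  · rw [← neg_inj, ← energyForm_single_single K.locallyFinite_of_finite hxy,
      ← energyForm_single_single K'.locallyFinite_of_finite hxy, hE]

end Finite

theorem connected_of_energyForm_eq_zero [Nonempty V]
    (h : ∀ v ∈ G.domE, G.energyForm v v = 0 → ∀ x y, v x = v y) : G.Connected := by
  classical
  refine ⟨fun x y => ?_⟩
  set v : V → ℝ := fun z => if G.toSimpleGraph.Reachable x z then 1 else 0 with hv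
  have hterm : ∀ p : V × V, G.c p.1 p.2 * (v p.1 - v p.2) ^ 2 = 0 := by
    rintro ⟨a, b⟩
    rcases (G.nonneg a b).eq_or_lt with hab | hab
    · simp [← hab]
    · have hadj : G.toSimpleGraph.Adj a b := hab
      have : G.toSimpleGraph.Reachable x a ↔ G.toSimpleGraph.Reachable x b :=
        ⟨fun h => h.trans hadj.reachable, fun h => h.trans hadj.reachable.symm⟩
      simp [v, this]
  have hmem : v ∈ G.domE := summable_zero.congr fun p => (hterm p).symm
  have hxy := h v hmem (by rw [energyForm_self, tsum_congr hterm, tsum_zero, mul_zero]) x y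
  by_contra hnot
  simp [hv, hnot] at hxy

end WeightedGraph

theorem sum_mul_sub_mul_sub_eq {ι : Type*} [Fintype ι] {b : ι → ι → ℝ}
    (hsymm : ∀ i j, b i j = b j i) (hsum : ∀ j, ∑ i, b i j = 0) (f g : ι → ℝ) :
    ∑ i, ∑ j, b i j * (f i - f j) * (g i - g j) = -2 * ∑ i, ∑ j, f i * g j * b i j := by
  have hcol : ∀ k : ι → ℝ, ∑ i, ∑ j, b i j * k j = 0 := by
    intro k
    rw [Finset.sum_comm]
    simp only [← Finset.sum_mul, hsum, zero_mul, Finset.sum_const_zero]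
  have hrow : ∀ k : ι → ℝ, ∑ i, ∑ j, b i j * k i = 0 := by
    intro k
    rw [Finset.sum_comm, ← hcol k]
    simp only [hsymm]
  have hswap : ∑ i, ∑ j, f j * g i * b i j = ∑ i, ∑ j, f i * g j * b i j := by
    rw [Finset.sum_comm]
    simp only [hsymm]
  calc ∑ i, ∑ j, b i j * (f i - f j) * (g i - g j)
      = ∑ i, ∑ j, (b i j * (f i * g i) + b i j * (f j * g j) - f i * g j * b i j
          - f j * g i * b i j) :=
        Finset.sum_congr rfl fun i _ => Finset.sum_congr rfl fun j _ => by ring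
    _ = -2 * ∑ i, ∑ j, f i * g j * b i j := by
        simp only [Finset.sum_sub_distrib, Finset.sum_add_distrib]
        rw [hcol fun j => f j * g j, hrow fun i => f i * g i, hswap]
        ring

namespace IsResistanceForm

section Trace

variable {X : Type*} {E : (X → ℝ) → (X → ℝ) → ℝ} {F : Set (X → ℝ)} (h : IsResistanceForm E F)
  {W : Finset X}

open Classical in
/-- The trace of a resistance form on a finite set `W`, as a weighted graph: its energy form is
`E` evaluated on harmonic extensions. -/
noncomputable def trace (W : Finset X) : WeightedGraph W where
  c x y := if x = y then 0 else -E (h.harmonicIndicator x) (h.harmonicIndicator y)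
  nonneg x y := by
    split_ifs with hxy
    · exact le_rfl
    · exact neg_nonneg.2 (h.map_harmonicIndicator_nonpos hxy)
  symm x y := by
    simp only [eq_comm (a := x), h.map_symm _ (h.harmonicIndicator_mem x) _
      (h.harmonicIndicator_mem y)]
  diag x := if_pos rfl

theorem energyForm_trace (f g : W → ℝ) :
    (h.trace W).energyForm f g = E (h.harmonicExtension f) (h.harmonicExtension g) := by
  have hterm : ∀ x y : W, (h.trace W).c x y * (f x - f y) * (g x - g y) =
      -(E (h.harmonicIndicator x) (h.harmonicIndicator y) * (f x - f y) * (g x - g y)) := by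
    intro x y
    rcases eq_or_ne x y with rfl | hxy
    · simp
    · simp only [trace, if_neg hxy, neg_mul]
  rw [WeightedGraph.energyForm, tsum_fintype, Fintype.sum_prod_type]
  simp only [hterm, Finset.sum_neg_distrib]
  rw [sum_mul_sub_mul_sub_eq
    (fun x y => h.map_symm _ (h.harmonicIndicator_mem x) _ (h.harmonicIndicator_mem y))
    h.sum_map_harmonicIndicator, h.map_harmonicExtension_harmonicExtension]
  ring

theorem trace_connected [Nonempty W] : (h.trace W).Connected := by
  refine WeightedGraph.connected_of_energyForm_eq_zero fun f _ hf x y => ?_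
  rw [energyForm_trace] at hf
  obtain ⟨k, hk⟩ := (h.map_eq_zero_iff _ (h.harmonicExtension_mem f)).1 hf
  rw [← h.harmonicExtension_apply f, ← h.harmonicExtension_apply f, hk, hk]

theorem resistance_trace (x y : W) :
    resistance (h.trace W).energyForm Set.univ x y = resistance E F x y := by
  rcases eq_or_ne x y with rfl | hxy
  · rw [resistance_self, resistance_self]
  have hval : (x : X) ≠ y := Subtype.coe_ne_coe.2 hxy
  obtain ⟨u, hu, hux, huy⟩ := h.exists_mem_eq_one_eq_zero hval
  refine inv_injective (le_antisymm ?_ ?_)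
  · refine le_inv_resistance ⟨u, hu, hux, huy⟩ fun u hu hux huy => ?_
    refine le_trans ?_ (h.map_harmonicExtension_le hu fun _ : W => rfl)
    rw [← h.energyForm_trace]
    exact inv_resistance_le (fun _ _ => WeightedGraph.energyForm_self_nonneg _) (Set.mem_univ _)
      hux huy
  · refine le_inv_resistance ⟨fun z => u z, Set.mem_univ _, hux, huy⟩ fun f _ hfx hfy => ?_
    rw [energyForm_trace]
    refine inv_resistance_le h.map_nonneg (h.harmonicExtension_mem f) ?_ ?_
    · rw [h.harmonicExtension_apply, hfx]
    · rw [h.harmonicExtension_apply, hfy]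

theorem representsOn_trace [Nonempty W] : RepresentsOn (resistance E F) W (h.trace W) :=
  ⟨h.trace_connected, fun x y => by
    rw [WeightedGraph.effectiveResistance_eq_resistance h.trace_connected, resistance_trace]⟩

end Trace

end IsResistanceForm

namespace IsFiniteExhaustion

variable {V : Type*} {W : ℕ → Finset V} (hW : IsFiniteExhaustion W)

include hW

theorem eventually_mem (x : V) : ∀ᶠ n in atTop, x ∈ W n := by
  obtain ⟨N, hN⟩ := hW.2 x
  filter_upwards [eventually_ge_atTop N] with n hn using hW.1 hn hN

theorem eventually_subset (S : Finset V) : ∀ᶠ n in atTop, S ⊆ W n :=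
  (eventually_all_finset S).2 fun x _ => hW.eventually_mem x

end IsFiniteExhaustion

namespace WeightedGraph

variable {V : Type*} {G : WeightedGraph V} {D : Set (V → ℝ)}

section LimitGraph

theorem trace_weight_eq_tsum (hfin : G.LocallyFinite) (hD : finiteFunctions V ⊆ D)
    (h : IsResistanceForm G.energyForm D) {W : Finset V} {x y : W} (hxy : x ≠ y) :
    (h.trace W).c x y = ∑' z, G.c y z * h.harmonicIndicator x z := by
  classical
  have hsum : Summable fun z => G.c y z * h.harmonicIndicator x z :=
    (hfin y).of_nonneg_of_le
      (fun z => mul_nonneg (G.nonneg _ _) (h.harmonicIndicator_mem_Icc x z).1)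
      (fun z => mul_le_of_le_one_right (G.nonneg _ _) (h.harmonicIndicator_mem_Icc x z).2)
  have hsingle : ∀ z : W, h.harmonicIndicator y z = (Pi.single (y : V) 1 : V → ℝ) z := by
    intro z
    rcases eq_or_ne y z with rfl | hyz
    · rw [h.harmonicIndicator_self, Pi.single_eq_same]
    · rw [h.harmonicIndicator_of_ne hyz, Pi.single_eq_of_ne (Subtype.coe_ne_coe.2 hyz.symm)]
  calc (h.trace W).c x y = -G.energyForm (h.harmonicIndicator x) (h.harmonicIndicator y) :=
        if_neg hxy
    _ = -G.energyForm (h.harmonicIndicator x) (Pi.single (y : V) 1) := congrArg _ <|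
        h.map_harmonicExtension_congr _ (h.harmonicIndicator_mem y)
          (hD (single_mem_finiteFunctions _)) hsingle
    _ = ∑' z, G.c y z * h.harmonicIndicator x z := by
        rw [energyForm_single hfin hsum, h.harmonicIndicator_of_ne hxy, mul_zero, zero_sub, neg_neg]

open Classical in
theorem tendsto_trace_weight (hfin : G.LocallyFinite) (hD : finiteFunctions V ⊆ D)
    (h : IsResistanceForm G.energyForm D) {W : ℕ → Finset V} (hW : IsFiniteExhaustion W)
    (x y : V) :
    Tendsto (fun n => if hn : x ∈ W n ∧ y ∈ W n then
      (h.trace (W n)).c ⟨x, hn.1⟩ ⟨y, hn.2⟩ else 0) atTop (𝓝 (G.c x y)) := by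
  rcases eq_or_ne x y with rfl | hxy
  · simpa only [diag, dite_eq_ite, ite_self] using tendsto_const_nhds
  set u : ℕ → V → ℝ := fun n => if hx : x ∈ W n then h.harmonicIndicator ⟨x, hx⟩ else 0 with hu
  have hbound : ∀ n z, ‖G.c y z * u n z‖ ≤ G.c y z := by
    intro n z
    rw [norm_mul, Real.norm_of_nonneg (G.nonneg _ _)]
    refine mul_le_of_le_one_right (G.nonneg _ _) ?_
    by_cases hx : x ∈ W n
    · have hIcc := h.harmonicIndicator_mem_Icc ⟨x, hx⟩ z
      simpa only [hu, dif_pos hx, Real.norm_of_nonneg hIcc.1] using hIcc.2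
    · simp [hu, dif_neg hx]
  have hlim : ∀ z, Tendsto (fun n => u n z) atTop (𝓝 ((Pi.single x 1 : V → ℝ) z)) := by
    intro z
    refine tendsto_const_nhds.congr' ?_
    filter_upwards [hW.eventually_mem x, hW.eventually_mem z] with n hx hz
    rcases eq_or_ne x z with rfl | hxz
    · simp only [hu, dif_pos hx, Pi.single_eq_same, h.harmonicIndicator_self ⟨x, hx⟩]
    · have hne : (⟨x, hx⟩ : W n) ≠ ⟨z, hz⟩ := Subtype.coe_ne_coe.1 hxz
      simp only [hu, dif_pos hx, Pi.single_eq_of_ne hxz.symm, h.harmonicIndicator_of_ne hne]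
  have htsum : Tendsto (fun n => ∑' z, G.c y z * u n z) atTop (𝓝 (G.c x y)) := by
    have := tendsto_tsum_of_dominated_convergence (hfin y) (fun z => (hlim z).const_mul (G.c y z))
      (Eventually.of_forall hbound)
    rwa [tsum_eq_single x fun z hz => by rw [Pi.single_eq_of_ne hz, mul_zero], Pi.single_eq_same,
      mul_one, G.symm y x] at this
  refine htsum.congr' ?_
  filter_upwards [hW.eventually_mem x, hW.eventually_mem y] with n hx hy
  rw [dif_pos ⟨hx, hy⟩, trace_weight_eq_tsum hfin hD h (Subtype.coe_ne_coe.1 hxy)]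
  simp only [hu, dif_pos hx]

theorem isLimitGraph_resistance (hfin : G.LocallyFinite) (hD : finiteFunctions V ⊆ D)
    (h : IsResistanceForm G.energyForm D) : IsLimitGraph (resistance G.energyForm D) G := by
  intro W hW hne
  refine ⟨fun n => h.trace (W n), fun n => ?_, tendsto_trace_weight hfin hD h hW⟩
  have := (hne n).to_subtype
  have hrep : RepresentsOn (resistance G.energyForm D) (W n) (h.trace (W n)) := h.representsOn_trace
  exact ⟨hrep, fun K hK => eq_of_effectiveResistance_eq hK.1 hrep.1 fun x y => by
    rw [hK.2, hrep.2]⟩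

end LimitGraph

section Free

theorem energyForm_induce (W : Finset V) (u : V → ℝ) :
    (G.induce W).energyForm (fun z => u z) (fun z => u z) =
      1 / 2 * ∑ p ∈ W ×ˢ W, G.c p.1 p.2 * (u p.1 - u p.2) ^ 2 := by
  rw [energyForm_self, tsum_fintype, Fintype.sum_prod_type, Finset.sum_product,
    ← Finset.sum_coe_sort W]
  refine congrArg _ (Finset.sum_congr rfl fun x _ => ?_)
  rw [← Finset.sum_coe_sort W]
  rfl

theorem energyForm_induce_le {u : V → ℝ} (hu : u ∈ G.domE) (W : Finset V) :
    (G.induce W).energyForm (fun z => u z) (fun z => u z) ≤ G.energyForm u u := by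
  rw [energyForm_induce]
  linarith [sum_le_two_mul_energyForm hu (W ×ˢ W)]

theorem sum_le_two_mul_energyForm_induce {W : Finset V} {S : Finset (V × V)} (hS : S ⊆ W ×ˢ W)
    (u : V → ℝ) : ∑ p ∈ S, G.c p.1 p.2 * (u p.1 - u p.2) ^ 2 ≤
      2 * (G.induce W).energyForm (fun z => u z) (fun z => u z) := by
  rw [energyForm_induce]
  linarith [Finset.sum_le_sum_of_subset_of_nonneg hS fun p _ _ => G.energy_term_nonneg u p]

theorem exists_energyForm_induce_eq {W : Finset V} (hW : (G.induce W).Connected) {x y : W}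
    (hxy : x ≠ y) :
    ∃ u : V → ℝ, u x = 1 ∧ u y = 0 ∧ (∀ z, u z ∈ Set.Icc (0 : ℝ) 1) ∧
      (G.induce W).energyForm (fun z => u z) (fun z => u z) =
        ((G.induce W).effectiveResistance x y)⁻¹ := by
  obtain ⟨f, -, hfx, hfy, hf, hfE⟩ :=
    (isResistanceForm_univ hW).exists_energy_eq_inv_resistance hxy
  have hext : ∀ z : W, Function.extend Subtype.val f 0 (z : V) = f z := fun z =>
    Subtype.val_injective.extend_apply f 0 z
  refine ⟨Function.extend Subtype.val f 0, (hext x).trans hfx, (hext y).trans hfy, fun z => ?_, ?_⟩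
  · by_cases hz : z ∈ W
    · exact hext ⟨z, hz⟩ ▸ hf ⟨z, hz⟩
    · rw [Function.extend_apply' _ _ _ fun ⟨w, hw⟩ => hz (hw ▸ w.2)]
      exact Set.left_mem_Icc.2 zero_le_one
  · rw [funext hext, hfE, effectiveResistance_eq_resistance hW]

theorem inv_effectiveResistance_induce_mem_Icc (hconn : G.Connected) (hfin : G.LocallyFinite)
    {W : Finset V} (hW : (G.induce W).Connected) {x y : W} (hxy : x ≠ y) :
    ((G.induce W).effectiveResistance x y)⁻¹ ∈
      Set.Icc 0 (resistance G.energyForm G.domE x y)⁻¹ := by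
  obtain ⟨f, -, -, -, hfE⟩ := exists_energyForm_induce_eq hW hxy
  obtain ⟨u, hu, hux, huy, -, huE⟩ :=
    (isResistanceForm_domE hconn hfin).exists_energy_eq_inv_resistance (Subtype.coe_ne_coe.2 hxy)
  refine ⟨hfE ▸ energyForm_self_nonneg _, ?_⟩
  rw [effectiveResistance_eq_resistance hW, ← huE]
  refine le_trans ?_ (energyForm_induce_le hu W)
  exact inv_resistance_le (fun _ _ => energyForm_self_nonneg _) (Set.mem_univ _) hux huy

theorem exists_tendsto_of_mem_Icc {ι : Type*} (U : Ultrafilter ι) {a b : ℝ} {f : ι → V → ℝ}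
    (hf : ∀ᶠ i in U, ∀ z, f i z ∈ Set.Icc a b) :
    ∃ v : V → ℝ, ∀ z, Tendsto (fun i => f i z) U (𝓝 (v z)) := by
  obtain ⟨v, -, hv⟩ := (isCompact_univ_pi fun _ : V => isCompact_Icc).ultrafilter_le_nhds
    (U.map f) (le_principal_iff.2 <| hf.mono fun _ hi z _ => hi z)
  exact ⟨v, tendsto_pi_nhds.1 hv⟩

theorem exists_mem_domE_tendsto {W : ℕ → Finset V} (hW : IsFiniteExhaustion W) {U : Ultrafilter ℕ}
    (hU : (U : Filter ℕ) ≤ atTop) {f : ℕ → V → ℝ} (hf : ∀ᶠ n in U, ∀ z, f n z ∈ Set.Icc (0 : ℝ) 1)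
    {a : ℝ} (ha : Tendsto (fun n => (G.induce (W n)).energyForm (fun z => f n z) (fun z => f n z))
      U (𝓝 a)) :
    ∃ u ∈ G.domE, (∀ z, Tendsto (fun n => f n z) U (𝓝 (u z))) ∧ G.energyForm u u ≤ a := by
  obtain ⟨u, hu⟩ := exists_tendsto_of_mem_Icc U hf
  have hsum : ∀ S : Finset (V × V), ∀ᶠ n in (U : Filter ℕ),
      ∑ p ∈ S, G.c p.1 p.2 * (f n p.1 - f n p.2) ^ 2 ≤
        2 * (G.induce (W n)).energyForm (fun z => f n z) (fun z => f n z) := by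
    classical
    intro S
    filter_upwards [hU (hW.eventually_subset (S.image Prod.fst)),
      hU (hW.eventually_subset (S.image Prod.snd))] with n hfst hsnd
    exact sum_le_two_mul_energyForm_induce
      (Finset.subset_product.trans (Finset.product_subset_product hfst hsnd)) _
  obtain ⟨hmem, hle⟩ := mem_domE_of_tendsto hu ha hsum
  exact ⟨u, hmem, hu, hle⟩

open Classical in
theorem tendsto_inv_effectiveResistance_induce (hconn : G.Connected) (hfin : G.LocallyFinite)
    {W : ℕ → Finset V} (hW : IsFiniteExhaustion W) (hWconn : ∀ n, (G.induce (W n)).Connected)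
    {x y : V} (hxy : x ≠ y) :
    Tendsto (fun n => (if hn : x ∈ W n ∧ y ∈ W n then
        (G.induce (W n)).effectiveResistance ⟨x, hn.1⟩ ⟨y, hn.2⟩ else 0)⁻¹)
      atTop (𝓝 (resistance G.energyForm G.domE x y)⁻¹) := by
  have h := isResistanceForm_domE hconn hfin
  set R : ℕ → ℝ := fun n => if hn : x ∈ W n ∧ y ∈ W n then
    (G.induce (W n)).effectiveResistance ⟨x, hn.1⟩ ⟨y, hn.2⟩ else 0 with hR
  change Tendsto (fun n => (R n)⁻¹) _ _
  have hmin : ∀ᶠ n in atTop, ∃ u : V → ℝ, u x = 1 ∧ u y = 0 ∧ (∀ z, u z ∈ Set.Icc (0 : ℝ) 1) ∧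
      (G.induce (W n)).energyForm (fun z => u z) (fun z => u z) = (R n)⁻¹ := by
    filter_upwards [hW.eventually_mem x, hW.eventually_mem y] with n hx hy
    simpa only [hR, dif_pos (And.intro hx hy)] using
      exists_energyForm_induce_eq (hWconn n) (x := ⟨x, hx⟩) (y := ⟨y, hy⟩) (by simpa using hxy)
  obtain ⟨f, hf⟩ := hmin.choice
  have hIcc : ∀ᶠ n in atTop, (R n)⁻¹ ∈ Set.Icc 0 (resistance G.energyForm G.domE x y)⁻¹ := by
    filter_upwards [hW.eventually_mem x, hW.eventually_mem y] with n hx hy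
    simpa only [hR, dif_pos (And.intro hx hy)] using
      inv_effectiveResistance_induce_mem_Icc hconn hfin (hWconn n) (x := ⟨x, hx⟩) (y := ⟨y, hy⟩)
        (by simpa using hxy)
  refine (tendsto_iff_ultrafilter _ _ _).2 fun U hU => ?_
  have hfU := hf.filter_mono hU
  obtain ⟨a, ha, hUa⟩ := isCompact_Icc.ultrafilter_le_nhds (U.map fun n => (R n)⁻¹)
    (le_principal_iff.2 (hU hIcc))
  have hRa : Tendsto (fun n => (R n)⁻¹) U (𝓝 a) := hUa
  obtain ⟨u, hu, hfu, huE⟩ := exists_mem_domE_tendsto hW hU (hfU.mono fun n hn => hn.2.2.1)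
    (hRa.congr' (hfU.mono fun n hn => hn.2.2.2.symm))
  have hux : u x = 1 := tendsto_nhds_unique (hfu x)
    (tendsto_const_nhds.congr' (hfU.mono fun n hn => hn.1.symm))
  have huy : u y = 0 := tendsto_nhds_unique (hfu y)
    (tendsto_const_nhds.congr' (hfU.mono fun n hn => hn.2.1.symm))
  exact ha.2.antisymm ((inv_resistance_le h.map_nonneg hu hux huy).trans huE) ▸ hRa

theorem isFreeEffectiveResistance_resistance_domE (hconn : G.Connected) (hfin : G.LocallyFinite) :
    IsFreeEffectiveResistance G (resistance G.energyForm G.domE) := by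
  intro W hW hWconn x y
  rcases eq_or_ne x y with rfl | hxy
  · simpa only [resistance_self, effectiveResistance_self, dite_eq_ite, ite_self]
      using tendsto_const_nhds
  exact (tendsto_inv_iff₀ ((isResistanceForm_domE hconn hfin).resistance_pos hxy).ne').1
    (tendsto_inv_effectiveResistance_induce hconn hfin hW hWconn hxy)

end Free

section FiniteClosure

theorem isResistanceForm_energyClosure_finiteFunctions (hconn : G.Connected)
    (hfin : G.LocallyFinite) :
    IsResistanceForm G.energyForm (energyClosure G.energyForm G.domE (finiteFunctions V)) := by
  have := hconn.nonempty
  exact (isResistanceForm_domE hconn hfin).energyClosure (A := finiteSubmodule V)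
    (finiteFunctions_subset_domE hfin) const_mem_finiteFunctions
    (fun _ => clamp_mem_finiteFunctions) exists_mem_finiteFunctions_eq

theorem resistance_energyClosure_finiteFunctions (hconn : G.Connected) (hfin : G.LocallyFinite) :
    resistance G.energyForm (energyClosure G.energyForm G.domE (finiteFunctions V)) =
      resistance G.energyForm (finiteFunctions V) :=
  (isResistanceForm_domE hconn hfin).resistance_energyClosure (A := finiteSubmodule V)
    (finiteFunctions_subset_domE hfin) const_mem_finiteFunctions exists_mem_finiteFunctions_eq

end FiniteClosure

section Wired

variable {W : Finset V} (v : Option W → ℝ)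

open Classical in
/-- The function on `V` corresponding to a function on the wired graph of `W`: the value at the
additional vertex is taken on all of `V \ W`. -/
noncomputable def wiredExtension : V → ℝ :=
  fun z => if hz : z ∈ W then v (some ⟨z, hz⟩) else v none

theorem wiredExtension_coe (z : W) : wiredExtension v z = v (some z) :=
  dif_pos z.2

theorem wiredExtension_of_notMem {z : V} (hz : z ∉ W) : wiredExtension v z = v none :=
  dif_neg hz

theorem wiredExtension_mem_finiteFunctions : wiredExtension v ∈ finiteFunctions V :=
  ⟨v none, W, fun _ => wiredExtension_of_notMem v⟩

theorem exists_wiredExtension_eq {u : V → ℝ} {k : ℝ} (hu : ∀ z, z ∉ W → u z = k) :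
    ∃ v : Option W → ℝ, wiredExtension v = u := by
  refine ⟨fun z => z.elim k fun z => u z, funext fun z => ?_⟩
  by_cases hz : z ∈ W
  · exact wiredExtension_coe _ ⟨z, hz⟩
  · rw [wiredExtension_of_notMem _ hz, hu z hz, Option.elim_none]

theorem hasSum_wiredExtension (hfin : G.LocallyFinite) (y : W) :
    HasSum (fun z => G.c y z * (wiredExtension v y - wiredExtension v z))
      (∑' z, (G.wire W).c (some y) z * (v (some y) - v z)) := by
  have hmem : HasSum ((fun z => G.c y z * (wiredExtension v y - wiredExtension v z)) ∘
      ((↑) : {z // z ∈ W} → V)) (∑ z : W, G.c y z * (v (some y) - v (some z))) := by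
    simpa only [Function.comp_def, wiredExtension_coe] using
      hasSum_fintype fun z : W => G.c y z * (v (some y) - v (some z))
  have hnotMem : HasSum ((fun z => G.c y z * (wiredExtension v y - wiredExtension v z)) ∘
      ((↑) : {z // z ∉ W} → V)) ((∑' z : {z // z ∉ W}, G.c y z) * (v (some y) - v none)) := by
    refine (((hfin y).subtype {z | z ∉ W}).hasSum.mul_right (v (some y) - v none)).congr_fun ?_
    rintro ⟨z, hz⟩
    simp only [Function.comp_apply, wiredExtension_coe, wiredExtension_of_notMem v hz]
  have hsum := HasSum.add_isCompl (s := {z | z ∈ W}) (t := {z | z ∉ W}) isCompl_compl hmem hnotMem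
  rwa [tsum_fintype, Fintype.sum_option, add_comm]

theorem energyForm_wire_single [DecidableEq V] (hfin : G.LocallyFinite) (y : W) :
    (G.wire W).energyForm v (Pi.single (some y) 1) =
      G.energyForm (wiredExtension v) (Pi.single (y : V) 1) := by
  rw [energyForm_single_of_hasSum (hasSum_wiredExtension v hfin y),
    energyForm_single_of_hasSum Summable.of_finite.hasSum]

theorem energyForm_wire (hfin : G.LocallyFinite) :
    (G.wire W).energyForm v v = G.energyForm (wiredExtension v) (wiredExtension v) := by
  classical
  have hwire : ∀ z, z ∉ (Finset.univ : Finset W).map Function.Embedding.some → v z = v none := by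
    rintro (_ | z) hz
    · rfl
    · exact absurd (Finset.mem_map_of_mem _ (Finset.mem_univ z)) hz
  rw [energyForm_eq_sum_of_eq_const (G.wire W).locallyFinite_of_finite
      ((G.wire W).domE_eq_univ ▸ Set.mem_univ v) hwire,
    energyForm_eq_sum_of_eq_const hfin
      (finiteFunctions_subset_domE hfin (wiredExtension_mem_finiteFunctions v))
      fun z => wiredExtension_of_notMem v,
    Finset.sum_map, ← Finset.sum_coe_sort W]
  simp only [Function.Embedding.some_apply, energyForm_wire_single v hfin, wiredExtension_coe]

variable (W) in
theorem wire_connected [Infinite V] (hconn : G.Connected) (hfin : G.LocallyFinite) :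
    (G.wire W).Connected := by
  obtain ⟨o, ho⟩ := Infinite.exists_notMem_finset W
  refine connected_of_energyForm_eq_zero fun v _ hv => ?_
  rw [energyForm_wire v hfin] at hv
  obtain ⟨k, hk⟩ := (energyForm_self_eq_zero_iff hconn
    (finiteFunctions_subset_domE hfin (wiredExtension_mem_finiteFunctions v))).1 hv
  have hconst : ∀ z, v z = k := by
    rintro (_ | z)
    · rw [← wiredExtension_of_notMem v ho, hk]
    · rw [← wiredExtension_coe v z, hk]
  exact fun x y => (hconst x).trans (hconst y).symm

theorem inv_resistance_le_inv_effectiveResistance_wire [Infinite V] (hconn : G.Connected)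
    (hfin : G.LocallyFinite) {x y : W} (hxy : x ≠ y) :
    (resistance G.energyForm (finiteFunctions V) x y)⁻¹ ≤
      ((G.wire W).effectiveResistance (some x) (some y))⁻¹ := by
  have hwire := wire_connected W hconn hfin
  rw [effectiveResistance_eq_resistance hwire]
  refine le_inv_resistance ((isResistanceForm_univ hwire).exists_mem_eq_one_eq_zero
    (Option.some_injective _ |>.ne hxy)) fun v _ hvx hvy => ?_
  rw [energyForm_wire v hfin]
  exact inv_resistance_le (fun _ _ => energyForm_self_nonneg _)
    (wiredExtension_mem_finiteFunctions v) (by rw [wiredExtension_coe, hvx])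
    (by rw [wiredExtension_coe, hvy])

theorem inv_effectiveResistance_wire_le [Infinite V] (hconn : G.Connected) (hfin : G.LocallyFinite)
    {x y : W} {u : V → ℝ} {k : ℝ} (hu : ∀ z, z ∉ W → u z = k) (hx : u x = 1) (hy : u y = 0) :
    ((G.wire W).effectiveResistance (some x) (some y))⁻¹ ≤ G.energyForm u u := by
  obtain ⟨v, rfl⟩ := exists_wiredExtension_eq hu
  rw [wiredExtension_coe] at hx hy
  rw [effectiveResistance_eq_resistance (wire_connected W hconn hfin), ← energyForm_wire v hfin]
  exact inv_resistance_le (fun _ _ => energyForm_self_nonneg _) (Set.mem_univ v) hx hy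

open Classical in
theorem tendsto_inv_effectiveResistance_wire [Infinite V] (hconn : G.Connected)
    (hfin : G.LocallyFinite) {W : ℕ → Finset V} (hW : IsFiniteExhaustion W) {x y : V}
    (hxy : x ≠ y) :
    Tendsto (fun n => (if hn : x ∈ W n ∧ y ∈ W n then
        (G.wire (W n)).effectiveResistance (some ⟨x, hn.1⟩) (some ⟨y, hn.2⟩) else 0)⁻¹)
      atTop (𝓝 (resistance G.energyForm (finiteFunctions V) x y)⁻¹) := by
  refine tendsto_order.2 ⟨fun a ha => ?_, fun b hb => ?_⟩
  · filter_upwards [hW.eventually_mem x, hW.eventually_mem y] with n hx hy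
    rw [dif_pos ⟨hx, hy⟩]
    exact ha.trans_le <| inv_resistance_le_inv_effectiveResistance_wire hconn hfin
      (x := ⟨x, hx⟩) (y := ⟨y, hy⟩) (by simpa using hxy)
  · obtain ⟨u, ⟨k, S, hS⟩, hux, huy, huE⟩ := exists_energy_lt_of_inv_resistance_lt
      ⟨_, single_mem_finiteFunctions x, Pi.single_eq_same x 1, Pi.single_eq_of_ne hxy.symm 1⟩ hb
    filter_upwards [hW.eventually_mem x, hW.eventually_mem y, hW.eventually_subset S]
      with n hx hy hn
    rw [dif_pos ⟨hx, hy⟩]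
    exact (inv_effectiveResistance_wire_le hconn hfin (fun z hz => hS z (mt (@hn z) hz))
      hux huy).trans_lt huE

theorem isWiredEffectiveResistance_resistance_finiteFunctions [Infinite V] (hconn : G.Connected)
    (hfin : G.LocallyFinite) :
    IsWiredEffectiveResistance G (resistance G.energyForm (finiteFunctions V)) := by
  intro W hW _ x y
  rcases eq_or_ne x y with rfl | hxy
  · simpa only [resistance_self, effectiveResistance_self, dite_eq_ite, ite_self]
      using tendsto_const_nhds
  have hpos := (isResistanceForm_energyClosure_finiteFunctions hconn hfin).resistance_pos hxy
  rw [resistance_energyClosure_finiteFunctions hconn hfin] at hpos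
  exact (tendsto_inv_iff₀ hpos.ne').1 (tendsto_inv_effectiveResistance_wire hconn hfin hW hxy)

end Wired

end WeightedGraph

open WeightedGraph

theorem mainTheorem4 {V : Type*} [Countable V] [Infinite V] (G : WeightedGraph V)
    (hconn : G.Connected) (hfin : G.LocallyFinite) :
    -- every admissible domain gives back the graph
    (∀ D : Set (V → ℝ), finiteFunctions V ⊆ D → D ⊆ G.domE →
      IsResistanceForm G.energyForm D → IsLimitGraph (resistance G.energyForm D) G) ∧
    -- the free effective resistance is covered, by the domain `dom E`
    (∃ R : V → V → ℝ, IsFreeEffectiveResistance G R ∧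
      finiteFunctions V ⊆ G.domE ∧ IsResistanceForm G.energyForm G.domE ∧
      R = resistance G.energyForm G.domE ∧ IsLimitGraph R G) ∧
    -- the wired effective resistance, an infimum over `Fin`, is covered as well
    (∃ R : V → V → ℝ, IsWiredEffectiveResistance G R ∧
      R = resistance G.energyForm (finiteFunctions V) ∧
      (∃ D : Set (V → ℝ), finiteFunctions V ⊆ D ∧ D ⊆ G.domE ∧
        IsResistanceForm G.energyForm D ∧ R = resistance G.energyForm D) ∧
      IsLimitGraph R G) := by
  have hdom := isResistanceForm_domE hconn hfin
  have hFin := finiteFunctions_subset_domE hfin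
  have hclosure := isResistanceForm_energyClosure_finiteFunctions hconn hfin
  have hsub := hdom.subset_energyClosure hFin
  have hres := resistance_energyClosure_finiteFunctions hconn hfin
  refine ⟨fun D hD _ h => isLimitGraph_resistance hfin hD h, ?_, ?_⟩
  · exact ⟨_, isFreeEffectiveResistance_resistance_domE hconn hfin, hFin, hdom, rfl,
      isLimitGraph_resistance hfin hFin hdom⟩
  · exact ⟨_, isWiredEffectiveResistance_resistance_finiteFunctions hconn hfin, rfl,
      ⟨_, hsub, energyClosure_subset _ _ _, hclosure, hres.symm⟩,
      hres ▸ isLimitGraph_resistance hfin hsub hclosure⟩
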